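/- **Setting.** Let $X\ge 0$ be an essentially bounded random variable on a probability space, with c.d.f. $F_X$ and essential supremum $\mathcal M$. Let $w_0\in\mathbb R$, $\rho\ge 0$, $\nu>0$, and write $\pi(Y)=(1+\rho)\mathbb E[Y]$, $(x)_+=\max\{x,0\}$ and $x\wedge y=\min\{x,y\}$. Let $U$ be a utility function which is twice differentiable with $U'>0$ and $U''<0$ on an open interval containing $[\,w_0-\mathcal M-\pi(X),\,w_0]$ (e.g. on $\mathbb R$). Let $\mathfrak C$ be the set of measurable $I$ with $0\le I(x)\le x$ for all $x\in[0,\mathcal M]$, and for $I\in\mathfrak C$ put $W_I(X)=w_0-X+I(X)-\pi(I(X))$ and $e_I(X)=I(X)-\pi(I(X))$. Consider $$\max_{I\in\mathfrak C}\ \mathbb E[U(W_I(X))]\quad\text{subject to}\quad \mathrm{var}[e_I(X)]\le\nu. \tag{P}$$ Define $VaR=\inf\{x\in[0,\mathcal M]:F_X(x)\ge \tfrac{\rho}{1+\rho}\}$; for $0\le d<\mathcal M$, $$\varphi(d)=\frac{\mathbb E[U'(W_{(x-d)_+}(X))]}{U'(w_0-d-\pi((X-d)_+))},$$ and (with $\sup\emptyset=0$)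 $d^*=\max\big\{\sup\{VaR\le d<\mathcal M:\varphi(d)\ge\tfrac1{1+\rho}\},\,VaR\big\}$. Further let $$d_L=\inf\{d\ge d^*:\mathrm{var}[(X-d)_+]\le\nu\},\quad m_L=\mathbb E[(X-d_L)_+],$$ $$K_U=\inf\{k\ge0:\mathrm{var}[X\wedge k]\ge\nu\},\quad m_U=\mathbb E[X\wedge K_U].$$ Call $I$ incentive compatible if $I(0)=0$ and $0\le I(y)-I(x)\le y-x$ for all $0\le x\le y\le\mathcal M$. **Theorem 3.1.** Assume $\nu<\mathrm{var}[(X-d^*)_+]$ and that $F_X$ is strictly increasing on $(0,\mathcal M)$. (i) If $\rho=0$, there are $m^*\in(m_L,m_U)$, $\beta^*>0$ and $I^*\in\mathfrak C$ such that for every $x\in(0,\mathcal M]$ the number $y=I^*(x)$ lies in $(0,x)$ and solves $$U'(w_0-x+y-m^*)-2\beta^*y-U'(w_0-m^*)=0,$$ and such that $\mathbb E[I^*(X)]=m^*$ and $\mathrm{var}[I^*(X)]=\nu$. The function $I^*$ is incentive compatible and solves (P), and every solution $J$ of (P) satisfies $J(X)=I^*(X)$ almost surely. The triple $(m^*,\beta^*,I^*)$,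 with $I^*$ restricted to $[0,\mathcal M]$, is the only one with the properties listed in the first sentence. (ii) If $\rho>0$, there are $m^*\in(m_L,m_U)$, $\tilde d\in(VaR,\mathcal M)$ and $I^*\in\mathfrak C$ such that $I^*(x)=0$ for $0\le x\le\tilde d$; for every $x\in(\tilde d,\mathcal M]$ the number $y=I^*(x)$ lies in $(0,x)$ and solves $$U'(w_0-(1+\rho)m^*-x+y)-U'(w_0-(1+\rho)m^*-\tilde d)=\frac{y}{m^*\rho}\Big(U'(w_0-(1+\rho)m^*-\tilde d)-(1+\rho)\,\mathbb E\big[U'(w_0-(1+\rho)m^*-X\wedge\tilde d)\big]\Big);$$ and $\mathbb E[I^*(X)]=m^*$, $\mathrm{var}[I^*(X)]=\nu$. The function $I^*$ is incentive compatible and solves (P), and every solution $J$ of (P) satisfies $J(X)=I^*(X)$ almost surely. The triple $(m^*,\tilde d,I^*)$, with $I^*$ restricted to $[0,\mathcal M]$, is the only one with $I^*$ incentive compatible that has the properties listed in the first sentence. (iii) In particular, a solution $J$ of (P) has a positive deductible (there is $\delta>0$ with $J(X)=0$ almost surely on $\{X\le\delta\}$) if and only if $\rho>0$. -/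

import Mathlib

open MeasureTheory ProbabilityTheory Set

noncomputable section

namespace VarianceContract

/-- `U` is a utility function on the open interval `S` (possibly unbounded, e.g. all of `ℝ`): it is
twice differentiable there, with `U' > 0` and `U'' < 0`. -/
structure IsUtilityOn (U : ℝ → ℝ) (S : Set ℝ) : Prop where
  isOpen : IsOpen S
  ordConnected : S.OrdConnected
  differentiable : ∀ w ∈ S, DifferentiableAt ℝ U w
  differentiable_deriv : ∀ w ∈ S, DifferentiableAt ℝ (deriv U) w
  deriv_pos : ∀ w ∈ S, 0 < deriv U w
  deriv_deriv_neg : ∀ w ∈ S, deriv (deriv U) w < 0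

variable {Ω : Type*} [MeasurableSpace Ω]

/-- The distribution function `F_X(x) = ℙ(X ≤ x)`. -/
def lossCdf (P : Measure Ω) (X : Ω → ℝ) (x : ℝ) : ℝ := P.real {ω | X ω ≤ x}

/-- The essential supremum `𝓜` of the loss. -/
def lossSup (P : Measure Ω) (X : Ω → ℝ) : ℝ := essSup X P

/-- The expected value premium `π(Y) = (1 + ρ) 𝔼[Y]`. -/
def premium (P : Measure Ω) (ρ : ℝ) (Y : Ω → ℝ) : ℝ := (1 + ρ) * ∫ ω, Y ω ∂P

/-- The insurer's risk exposure `e_I(X) = I(X) - π(I(X))`. -/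
def exposure (P : Measure Ω) (X : Ω → ℝ) (ρ : ℝ) (I : ℝ → ℝ) (ω : Ω) : ℝ :=
  I (X ω) - premium P ρ (fun ω' => I (X ω'))

/-- The insured's final wealth `W_I(X) = w₀ - X + I(X) - π(I(X))`. -/
def finalWealth (P : Measure Ω) (X : Ω → ℝ) (w₀ ρ : ℝ) (I : ℝ → ℝ) (ω : Ω) : ℝ :=
  w₀ - X ω + I (X ω) - premium P ρ (fun ω' => I (X ω'))

/-- The expected utility `𝔼[U(W_I(X))]`. -/
def expectedUtility (P : Measure Ω) (X : Ω → ℝ) (U : ℝ → ℝ) (w₀ ρ : ℝ) (I : ℝ → ℝ) : ℝ :=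
  ∫ ω, U (finalWealth P X w₀ ρ I ω) ∂P

/-- The indemnity functions: (Borel) `I` with `0 ≤ I(x) ≤ x` on `[0, 𝓜]`. Values outside `[0, 𝓜]`
are irrelevant. -/
def IsIndemnity (P : Measure Ω) (X : Ω → ℝ) (I : ℝ → ℝ) : Prop :=
  Measurable I ∧ ∀ x ∈ Icc 0 (lossSup P X), 0 ≤ I x ∧ I x ≤ x

/-- Incentive compatibility: `I(0) = 0` and `0 ≤ I' ≤ 1` a.e. for the (absolutely) continuous `I`,
that is, all increments of `I` on `[0, 𝓜]` lie between `0` and the increment of the loss. -/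
def IsIncentiveCompatible (P : Measure Ω) (X : Ω → ℝ) (I : ℝ → ℝ) : Prop :=
  I 0 = 0 ∧ ∀ x ∈ Icc 0 (lossSup P X), ∀ y ∈ Icc 0 (lossSup P X), x ≤ y →
    0 ≤ I y - I x ∧ I y - I x ≤ y - x

/-- Feasibility: an indemnity function whose insurer's exposure has variance at most `ν`. -/
def IsAdmissible (P : Measure Ω) (X : Ω → ℝ) (ρ ν : ℝ) (I : ℝ → ℝ) : Prop :=
  IsIndemnity P X I ∧ variance (exposure P X ρ I) P ≤ ν

/-- `I` maximizes the expected utility over all feasible indemnity functions. -/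
def IsOptimal (P : Measure Ω) (X : Ω → ℝ) (U : ℝ → ℝ) (w₀ ρ ν : ℝ) (I : ℝ → ℝ) : Prop :=
  IsAdmissible P X ρ ν I ∧
    ∀ J : ℝ → ℝ, IsAdmissible P X ρ ν J →
      expectedUtility P X U w₀ ρ J ≤ expectedUtility P X U w₀ ρ I

/-- The deductible indemnity `x ↦ (x - d)₊`. -/
def stopLoss (d x : ℝ) : ℝ := max (x - d) 0

/-- `VaR_{1/(1+ρ)}(X) = inf {x ∈ [0, 𝓜] : F_X(x) ≥ ρ/(1+ρ)}` (the set contains `𝓜`). -/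
def valueAtRisk (P : Measure Ω) (X : Ω → ℝ) (ρ : ℝ) : ℝ :=
  sInf {x | x ∈ Icc 0 (lossSup P X) ∧ ρ / (1 + ρ) ≤ lossCdf P X x}

/-- `φ(d) = 𝔼[U'(W_{(x-d)₊}(X))] / U'(w₀ - d - π((X-d)₊))`. -/
def phi (P : Measure Ω) (X : Ω → ℝ) (U : ℝ → ℝ) (w₀ ρ d : ℝ) : ℝ :=
  (∫ ω, deriv U (finalWealth P X w₀ ρ (stopLoss d) ω) ∂P) /
    deriv U (w₀ - d - premium P ρ (fun ω => stopLoss d (X ω)))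

/-- Arrow's deductible `d*`
(`sSup` of a set bounded by `𝓜`; `sSup ∅ = 0` agrees with the usual convention). -/
def arrowDeductible (P : Measure Ω) (X : Ω → ℝ) (U : ℝ → ℝ) (w₀ ρ : ℝ) : ℝ :=
  max (sSup {d | valueAtRisk P X ρ ≤ d ∧ d < lossSup P X ∧ 1 / (1 + ρ) ≤ phi P X U w₀ ρ d})
    (valueAtRisk P X ρ)

/-- `d_L = inf {d ≥ d* : var[(X-d)₊] ≤ ν}`. -/
def deductibleL (P : Measure Ω) (X : Ω → ℝ) (U : ℝ → ℝ) (w₀ ρ ν : ℝ) : ℝ :=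
  sInf {d | arrowDeductible P X U w₀ ρ ≤ d ∧ variance (fun ω => stopLoss d (X ω)) P ≤ ν}

/-- `m_L = 𝔼[(X-d_L)₊]`. -/
def meanL (P : Measure Ω) (X : Ω → ℝ) (U : ℝ → ℝ) (w₀ ρ ν : ℝ) : ℝ :=
  ∫ ω, stopLoss (deductibleL P X U w₀ ρ ν) (X ω) ∂P

/-- `K_U = inf {k ≥ 0 : var[X ∧ k] ≥ ν}`. -/
def capU (P : Measure Ω) (X : Ω → ℝ) (ν : ℝ) : ℝ :=
  sInf {k | 0 ≤ k ∧ ν ≤ variance (fun ω => min (X ω) k) P}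

/-- `m_U = 𝔼[X ∧ K_U]`. -/
def meanU (P : Measure Ω) (X : Ω → ℝ) (ν : ℝ) : ℝ := ∫ ω, min (X ω) (capU P X ν) ∂P

/-- The system for `ρ = 0`: the indemnity function `I`, with parameters `m ∈ (m_L, m_U)` and `β > 0`,
is such that `y = I(x) ∈ (0, x)` solves `U'(w₀ - x + y - m) - 2βy - U'(w₀ - m) = 0` for all
`x ∈ (0, 𝓜]`, and `𝔼[I(X)] = m`, `var[I(X)] = ν`. -/
def SolvesCoinsurance (P : Measure Ω) (X : Ω → ℝ) (U : ℝ → ℝ) (w₀ ν : ℝ)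
    (m β : ℝ) (I : ℝ → ℝ) : Prop :=
  IsIndemnity P X I ∧
  m ∈ Ioo (meanL P X U w₀ 0 ν) (meanU P X ν) ∧
  0 < β ∧
  (∀ x ∈ Ioc 0 (lossSup P X), I x ∈ Ioo 0 x ∧
    deriv U (w₀ - x + I x - m) - 2 * β * I x - deriv U (w₀ - m) = 0) ∧
  ∫ ω, I (X ω) ∂P = m ∧
  variance (fun ω => I (X ω)) P = ν

/-- The system for `ρ > 0`: the indemnity function `I`, with parameters `m ∈ (m_L, m_U)` and
`d ∈ (VaR, 𝓜)`, vanishes on `[0, d]`; for `x ∈ (d, 𝓜]` the value `y = I(x) ∈ (0, x)` solves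
`U'(a - x + y) - U'(a - d) = y / (mρ) * (U'(a - d) - (1+ρ) 𝔼[U'(a - X ∧ d)])` with
`a = w₀ - (1+ρ)m`; and `𝔼[I(X)] = m`, `var[I(X)] = ν`. -/
def SolvesDeductibleCoinsurance (P : Measure Ω) (X : Ω → ℝ) (U : ℝ → ℝ) (w₀ ρ ν : ℝ)
    (m d : ℝ) (I : ℝ → ℝ) : Prop :=
  IsIndemnity P X I ∧
  m ∈ Ioo (meanL P X U w₀ ρ ν) (meanU P X ν) ∧
  d ∈ Ioo (valueAtRisk P X ρ) (lossSup P X) ∧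
  (∀ x ∈ Icc 0 d, I x = 0) ∧
  (∀ x ∈ Ioc d (lossSup P X), I x ∈ Ioo 0 x ∧
    deriv U (w₀ - (1 + ρ) * m - x + I x) - deriv U (w₀ - (1 + ρ) * m - d) =
      I x / (m * ρ) * (deriv U (w₀ - (1 + ρ) * m - d) -
        (1 + ρ) * ∫ ω, deriv U (w₀ - (1 + ρ) * m - min (X ω) d) ∂P)) ∧
  ∫ ω, I (X ω) ∂P = m ∧
  variance (fun ω => I (X ω)) P = ν

end VarianceContract

end

/-!
Everything depends on the loss through its law `μ`, so the problem is one of choosing an indemnity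
function on `[0, M]`. It is concave: the utility is concave, wealth is linear in the indemnity, and
the variance is convex. A contract that satisfies the first-order conditions, with a multiplier
`θ ≥ 0` for half the variance, is therefore optimal, and every other optimal contract leads to the
same wealth and hence, since indemnities are small at small losses, is almost surely equal to it
(`expectedUtility_le_of_isStationary`, `ae_eq_of_isStationary`). Both systems of the theorem are such
first-order conditions. They have a common form (`IsSolution`): with `m = 𝔼[I(X)]` and
`a = w₀ - (1 + ρ) m`, the indemnity vanishes up to a deductible `d`, solves
`U'(a - x + I) - θ I = U'(a - d)` above it, and `θ` satisfies
`θ ρ m = U'(a - d) - (1 + ρ) 𝔼[U'(a - X ∧ d)]`. For `ρ = 0` the last equation forces `d = 0`, and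
for `ρ > 0` it forces `d > 0`. This gives uniqueness of the solution of each system.

Existence is obtained by going backwards. An optimal contract exists because closed bounded convex
sets in `L²(μ)` are weakly compact (`exists_optimal`). Comparing it with its mixtures with other
contracts, and separating two convex sets in the plane, yields a multiplier `θ` and the sign of the
Lagrangian gradient `U'(W) - θ I - κ` wherever a constraint `0 ≤ I(x) ≤ x` binds
(`IsMaximizer.exists_lagrangian_sign`). Full insurance of small losses would make the mean of this
gradient too large, so `κ ≥ U'(a)`, and `κ = U'(a - d)` for a deductible `d`
(`marginal_le_of_hasLagrangianSigns`). If `θ` were zero, the contract would be of stop-loss type and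
optimal without the variance constraint; its deductible would exceed `d*` because the constraint is
binding at `d*`, which contradicts the definition of `d*` (`IsMaximizer.exists_isCoinsurance`).

The bounds `m_L < m < m_U` come from single-crossing comparisons: for a given variance, capped full
insurance has the largest mean, and stop-loss insurance the smallest (`ae_sub_eq_of_crossing`).
-/

namespace VarianceContract

open Filter Topology

set_option linter.unusedSectionVars false

/-! ### Convex optimization in Hilbert spaces and in the plane -/

/-- The weak compactness that the existence proof needs. The elements of least norm of the sets
form a Cauchy sequence by the parallelogram law. -/
theorem nonempty_iInter_of_antitone_convex {H : Type*} [NormedAddCommGroup H]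
    [InnerProductSpace ℝ H] [CompleteSpace H] {C : ℕ → Set H} (hanti : Antitone C)
    (hne : ∀ n, (C n).Nonempty) (hconv : ∀ n, Convex ℝ (C n)) (hclosed : ∀ n, IsClosed (C n))
    (hbdd : Bornology.IsBounded (C 0)) : (⋂ n, C n).Nonempty := by
  have hmin : ∀ n, ∃ x ∈ C n, ∀ w ∈ C n, ‖x‖ ≤ ‖w‖ := by
    intro n
    obtain ⟨x, hx, hxe⟩ := exists_norm_eq_iInf_of_complete_convex (hne n)
      (hclosed n).isComplete (hconv n) (0 : H)
    refine ⟨x, hx, fun w hw => ?_⟩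
    have h : (⨅ w : C n, ‖(0 : H) - w‖) ≤ ‖(0 : H) - w‖ :=
      ciInf_le ⟨0, by rintro _ ⟨w, rfl⟩; exact norm_nonneg _⟩ (⟨w, hw⟩ : C n)
    rw [← hxe] at h
    simpa using h
  choose x hx hxmin using hmin
  obtain ⟨R, hR⟩ := hbdd.exists_norm_le
  have hmem : ∀ {n m}, n ≤ m → x m ∈ C n := fun h => hanti h (hx _)
  have hmono : Monotone fun n => ‖x n‖ := fun n m h => hxmin n _ (hmem h)
  have hbd : BddAbove (range fun n => ‖x n‖) :=
    ⟨R, by rintro _ ⟨n, rfl⟩; exact hR _ (hmem (Nat.zero_le n))⟩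
  set l := ⨆ n, ‖x n‖ with hl
  have hlim : Tendsto (fun n => ‖x n‖) atTop (𝓝 l) := tendsto_atTop_ciSup hmono hbd
  have hle : ∀ n, ‖x n‖ ≤ l := fun n => le_ciSup hbd n
  have key : ∀ N n m, N ≤ n → n ≤ m → ‖x n - x m‖ ^ 2 ≤ 2 * l ^ 2 - 2 * ‖x N‖ ^ 2 := by
    intro N n m hN hnm
    have hpar := parallelogram_law_with_norm ℝ (x n) (x m)
    have hmid : (1 / 2 : ℝ) • x n + (1 / 2 : ℝ) • x m ∈ C n :=
      hconv n (hx n) (hmem hnm) (by norm_num) (by norm_num) (by norm_num)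
    have h1 := hxmin n _ hmid
    rw [← smul_add, norm_smul, Real.norm_of_nonneg (by norm_num)] at h1
    have h2 := hmono hN
    have h3 := hle m
    have h4 := norm_nonneg (x N)
    have h5 := norm_nonneg (x m)
    simp only at h2
    nlinarith [norm_nonneg (x n)]
  have hcauchy : CauchySeq x := by
    refine cauchySeq_of_le_tendsto_0 (fun N => √(2 * l ^ 2 - 2 * ‖x N‖ ^ 2)) ?_ ?_
    · intro n m N hn hm
      refine Real.le_sqrt_of_sq_le ?_
      rcases le_total n m with h | h
      · rw [dist_eq_norm]; exact key N n m hn h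
      · rw [dist_comm, dist_eq_norm]; exact key N m n hm h
    · have : Tendsto (fun N => √(2 * l ^ 2 - 2 * ‖x N‖ ^ 2)) atTop
          (𝓝 (√(2 * l ^ 2 - 2 * l ^ 2))) :=
        (Real.continuous_sqrt.tendsto _).comp
          (tendsto_const_nhds.sub ((hlim.pow 2).const_mul 2))
      simpa using this
  obtain ⟨z, hz⟩ := cauchySeq_tendsto_of_complete hcauchy
  refine ⟨z, mem_iInter.2 fun n => (hclosed n).mem_of_tendsto hz ?_⟩
  filter_upwards [eventually_ge_atTop n] with m hm using hmem hm

theorem exists_forall_le_of_concaveOn {H : Type*} [NormedAddCommGroup H]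
    [InnerProductSpace ℝ H] [CompleteSpace H] {K : Set H} {Φ : H → ℝ} (hne : K.Nonempty)
    (hclosed : IsClosed K) (hbdd : Bornology.IsBounded K) (hΦ : ConcaveOn ℝ K Φ)
    (hcont : Continuous Φ) (hsup : BddAbove (Φ '' K)) : ∃ f ∈ K, ∀ g ∈ K, Φ g ≤ Φ f := by
  set s := sSup (Φ '' K)
  have hn : ∀ n : ℕ, (0 : ℝ) < 1 / ((n : ℝ) + 1) := fun n => Nat.one_div_pos_of_nat
  obtain ⟨f, hf⟩ := nonempty_iInter_of_antitone_convex
    (C := fun n : ℕ => {f ∈ K | s - 1 / ((n : ℝ) + 1) ≤ Φ f})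
    (fun n m h f hf => ⟨hf.1, by
      have := Nat.one_div_le_one_div (α := ℝ) h
      linarith [hf.2]⟩)
    (fun n => by
      obtain ⟨_, ⟨f, hfK, rfl⟩, hf⟩ := exists_lt_of_lt_csSup (hne.image Φ)
        (show s - 1 / ((n : ℝ) + 1) < s by linarith [hn n])
      exact ⟨f, hfK, hf.le⟩)
    (fun n => hΦ.quasiconcaveOn _)
    (fun n => hclosed.inter (isClosed_le continuous_const hcont))
    (hbdd.subset fun f hf => hf.1)
  rw [mem_iInter] at hf
  refine ⟨f, (hf 0).1, fun g hg => ?_⟩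
  have h1 : Φ g ≤ s := le_csSup hsup ⟨g, hg, rfl⟩
  have h2 : s ≤ Φ f := by
    have ht : Tendsto (fun n : ℕ => s - 1 / ((n : ℝ) + 1)) atTop (𝓝 (s - 0)) :=
      tendsto_const_nhds.sub tendsto_one_div_add_atTop_nhds_zero_nat
    rw [sub_zero] at ht
    exact le_of_tendsto' ht fun n => (hf n).2
  exact h1.trans h2

/-- The separation behind the Lagrange multiplier: `p.1` is the first-order change of the
constraint and `p.2` that of the objective. -/
theorem exists_slope_of_convex {C : Set (ℝ × ℝ)} (hC : Convex ℝ C)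
    (hneg : ∀ p ∈ C, p.1 < 0 → p.2 ≤ 0) (hex : ∃ p ∈ C, p.1 < 0) :
    ∃ θ : ℝ, 0 ≤ θ ∧ ∀ p ∈ C, p.2 ≤ θ * p.1 := by
  set T := (fun p : ℝ × ℝ => p.2 / p.1) '' {p ∈ C | p.1 < 0}
  have hTne : T.Nonempty := by
    obtain ⟨p, hp, hp1⟩ := hex
    exact ⟨_, p, ⟨hp, hp1⟩, rfl⟩
  have hT0 : ∀ t ∈ T, 0 ≤ t := by
    rintro _ ⟨p, ⟨hp, hp1⟩, rfl⟩
    exact div_nonneg_of_nonpos (hneg p hp hp1) hp1.le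
  have hcross : ∀ p ∈ C, 0 ≤ p.1 → ∀ q ∈ C, q.1 < 0 → p.2 * -q.1 + q.2 * p.1 ≤ 0 := by
    intro p hp hp1 q hq hq1
    -- a mixture that weighs `q` slightly more than the one on the axis has negative first entry
    have hmix : ∀ ε > 0, p.2 * -q.1 + q.2 * (p.1 + ε) ≤ 0 := by
      intro ε hε
      have hs : 0 < -q.1 + (p.1 + ε) := by linarith
      have hm := hC hp hq (a := -q.1 / (-q.1 + (p.1 + ε)))
        (b := (p.1 + ε) / (-q.1 + (p.1 + ε))) (div_nonneg (by linarith) hs.le)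
        (div_nonneg (by linarith) hs.le) (by rw [← add_div, div_self hs.ne'])
      have h1 : (-q.1 / (-q.1 + (p.1 + ε)) * p.1 + (p.1 + ε) / (-q.1 + (p.1 + ε)) * q.1) =
          ε * q.1 / (-q.1 + (p.1 + ε)) := by
        field_simp; ring
      have h2 : (-q.1 / (-q.1 + (p.1 + ε)) * p.2 + (p.1 + ε) / (-q.1 + (p.1 + ε)) * q.2) =
          (p.2 * -q.1 + q.2 * (p.1 + ε)) / (-q.1 + (p.1 + ε)) := by
        field_simp
      have h3 := hneg _ hm
      simp only [Prod.fst_add, Prod.smul_fst, smul_eq_mul, Prod.snd_add, Prod.smul_snd] at h3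
      rw [h1, h2] at h3
      have h4 := h3 (div_neg_of_neg_of_pos (mul_neg_of_pos_of_neg hε hq1) hs)
      by_contra! h5
      exact absurd h4 (not_le.2 (div_pos h5 hs))
    have hlim : Tendsto (fun ε : ℝ => p.2 * -q.1 + q.2 * (p.1 + ε)) (𝓝[>] 0)
        (𝓝 (p.2 * -q.1 + q.2 * (p.1 + 0))) :=
      (Continuous.tendsto (by fun_prop) 0).mono_left nhdsWithin_le_nhds
    rw [add_zero] at hlim
    exact le_of_tendsto hlim (by filter_upwards [self_mem_nhdsWithin] with ε hε using hmix ε hε)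
  refine ⟨sInf T, le_csInf hTne hT0, fun p hp => ?_⟩
  rcases lt_or_ge p.1 0 with hp1 | hp1
  · have : sInf T ≤ p.2 / p.1 := csInf_le ⟨0, fun t ht => hT0 t ht⟩ ⟨p, ⟨hp, hp1⟩, rfl⟩
    rwa [le_div_iff_of_neg hp1] at this
  · rcases hp1.eq_or_lt with h0 | h0
    · obtain ⟨q, hq, hq1⟩ := hex
      have := hcross p hp hp1 q hq hq1
      rw [← h0] at this ⊢
      nlinarith
    · rw [← div_le_iff₀ h0]
      refine le_csInf hTne ?_
      rintro _ ⟨q, ⟨hq, hq1⟩, rfl⟩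
      have := hcross p hp hp1 q hq hq1
      rw [le_div_iff_of_neg hq1, div_mul_eq_mul_div, le_div_iff₀ h0]
      linarith

/-! ### Variances -/

theorem variance_comp_le_of_contraction {α : Type*} [MeasurableSpace α] {μ : Measure α}
    [IsProbabilityMeasure μ] {f : α → ℝ} (hf : MemLp f 2 μ) {φ : ℝ → ℝ}
    (hφ : LipschitzWith 1 φ) : variance (fun x => φ (f x)) μ ≤ variance f μ := by
  have hm : AEStronglyMeasurable (fun x => φ (f x)) μ :=
    hφ.continuous.comp_aestronglyMeasurable hf.1
  rw [← variance_sub_const hm (φ (∫ x, f x ∂μ)), variance_eq_integral hf.aemeasurable]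
  refine (variance_le_expectation_sq (hm.sub aestronglyMeasurable_const)).trans ?_
  refine integral_mono_of_nonneg (ae_of_all _ fun x => sq_nonneg _)
    (hf.sub (memLp_const _)).integrable_sq (ae_of_all _ fun x => ?_)
  have := hφ.dist_le_mul (f x) (∫ x, f x ∂μ)
  simp only [Real.dist_eq, NNReal.coe_one, one_mul] at this
  exact sq_le_sq.2 this

theorem variance_eq_add_cross {α : Type*} [MeasurableSpace α] {μ : Measure α}
    [IsProbabilityMeasure μ] {f g : α → ℝ} (hf : MemLp f 2 μ) (hg : MemLp g 2 μ) :
    variance (fun x => f x + g x) μ =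
      variance f μ + 2 * (∫ x, (f x - ∫ y, f y ∂μ) * g x ∂μ) + variance g μ := by
  have hfi := hf.integrable one_le_two
  have hgi := hg.integrable one_le_two
  have hfg : Integrable (fun x => f x * g x) μ := hf.integrable_mul hg
  have hff : Integrable (fun x => f x ^ 2) μ := hf.integrable_sq
  have hgg : Integrable (fun x => g x ^ 2) μ := hg.integrable_sq
  rw [variance_eq_sub hf, variance_eq_sub hg, variance_eq_sub (X := fun x => f x + g x) (hf.add hg)]
  have h1 : ∫ x, f x + g x ∂μ = ∫ x, f x ∂μ + ∫ x, g x ∂μ := integral_add hfi hgi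
  have h2 : ∫ x, (f x - ∫ y, f y ∂μ) * g x ∂μ =
      ∫ x, f x * g x ∂μ - (∫ x, f x ∂μ) * ∫ x, g x ∂μ := by
    simp_rw [sub_mul]
    rw [integral_sub hfg (hgi.const_mul _), integral_const_mul]
  have h3 : ∫ x, (f x + g x) ^ 2 ∂μ =
      ∫ x, f x ^ 2 ∂μ + 2 * (∫ x, f x * g x ∂μ) + ∫ x, g x ^ 2 ∂μ := by
    have h4 : Integrable (fun x => f x ^ 2 + 2 * (f x * g x)) μ := hff.add (hfg.const_mul 2)
    rw [← integral_const_mul, ← integral_add hff (hfg.const_mul 2), ← integral_add h4 hgg]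
    congr 1; ext x; ring
  simp only [Pi.pow_apply]
  rw [h1, h2, h3]
  ring

theorem memLp_top_mul {α : Type*} [MeasurableSpace α] {μ : Measure α} {f g : α → ℝ}
    (hf : MemLp f ⊤ μ) (hg : MemLp g ⊤ μ) : MemLp (fun x => f x * g x) ⊤ μ :=
  MemLp.mul (p := ⊤) (q := ⊤) hg hf

theorem memLp_two_of_top {α : Type*} [MeasurableSpace α] {μ : Measure α}
    [IsProbabilityMeasure μ] {f : α → ℝ} (hf : MemLp f ⊤ μ) : MemLp f 2 μ :=
  hf.mono_exponent le_top

theorem integrable_of_memLp_top {α : Type*} [MeasurableSpace α] {μ : Measure α}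
    [IsProbabilityMeasure μ] {f : α → ℝ} (hf : MemLp f ⊤ μ) : Integrable f μ :=
  hf.integrable le_top

/-! ### The insurance problem on the law of the loss -/

/-- The insurance problem in terms of the law `μ` of the loss, with essential supremum `M`. The
functions `u` and `v` stand for the utility and its derivative; only their behaviour on the interval
of attainable wealth levels matters, so they are taken to be bounded and continuous on `ℝ`, and the
relation between them is the strict tangent inequality. -/
structure IsInsuranceModel (μ : Measure ℝ) (M w₀ ρ : ℝ) (u v : ℝ → ℝ) : Prop where
  sup_pos : 0 < M
  ae_mem : ∀ᵐ x ∂μ, x ∈ Icc 0 M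
  measure_Ioo_ne_zero : ∀ a b, 0 ≤ a → a < b → b ≤ M → μ (Ioo a b) ≠ 0
  loading_nonneg : 0 ≤ ρ
  lipschitz : ∃ C, LipschitzWith C u
  bounded : ∃ C, ∀ w, |u w| ≤ C
  marginal_continuous : Continuous v
  marginal_bounded : ∃ C, ∀ w, |v w| ≤ C
  marginal_pos : ∀ w, 0 < v w
  marginal_strictAntiOn : StrictAntiOn v (Icc (w₀ - M - (1 + ρ) * ∫ x, x ∂μ) w₀)
  tangent : ∀ a ∈ Icc (w₀ - M - (1 + ρ) * ∫ x, x ∂μ) w₀,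
    ∀ b ∈ Icc (w₀ - M - (1 + ρ) * ∫ x, x ∂μ) w₀, a ≠ b → u b < u a + v a * (b - a)

/-- The indemnity functions for a loss with essential supremum `M`. -/
def IsContract (M : ℝ) (I : ℝ → ℝ) : Prop :=
  Measurable I ∧ ∀ x ∈ Icc 0 M, 0 ≤ I x ∧ I x ≤ x

/-- The final wealth `w₀ - x + I(x) - (1 + ρ) ∫ I` as a function of the loss `x`. -/
noncomputable def wealth (μ : Measure ℝ) (w₀ ρ : ℝ) (I : ℝ → ℝ) (x : ℝ) : ℝ :=
  w₀ - x + I x - (1 + ρ) * ∫ y, I y ∂μ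

/-- The gradient of the expected utility at `I`: the first-order effect of paying one more unit at
the loss `x`, which also raises the premium. -/
noncomputable def gradient (μ : Measure ℝ) (w₀ ρ : ℝ) (v : ℝ → ℝ) (I : ℝ → ℝ) (x : ℝ) : ℝ :=
  v (wealth μ w₀ ρ I x) - (1 + ρ) * ∫ y, v (wealth μ w₀ ρ I y) ∂μ

namespace IsInsuranceModel

variable {μ : Measure ℝ} [IsProbabilityMeasure μ] {M w₀ ρ : ℝ} {u v : ℝ → ℝ}

theorem exists_mem_Ioo_of_ae (h : IsInsuranceModel μ M w₀ ρ u v) {a b : ℝ} (ha : 0 ≤ a)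
    (hab : a < b) (hb : b ≤ M) {p : ℝ → Prop} (hp : ∀ᵐ x ∂μ, p x) : ∃ x ∈ Ioo a b, p x :=
  ((frequently_ae_mem_iff.2 (h.measure_Ioo_ne_zero a b ha hab hb)).and_eventually hp).exists

theorem memLp_top_contract (h : IsInsuranceModel μ M w₀ ρ u v) {I : ℝ → ℝ}
    (hI : IsContract M I) : MemLp I ⊤ μ := by
  refine memLp_top_of_bound hI.1.aestronglyMeasurable M ?_
  filter_upwards [h.ae_mem] with x hx
  rw [Real.norm_of_nonneg (hI.2 x hx).1]
  exact (hI.2 x hx).2.trans hx.2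

theorem isContract_id : IsContract M (fun x => x) :=
  ⟨measurable_id, fun _ hx => ⟨hx.1, le_rfl⟩⟩

theorem isContract_zero : IsContract M (fun _ => 0) :=
  ⟨measurable_const, fun _ hx => ⟨le_rfl, hx.1⟩⟩

theorem memLp_top_id (h : IsInsuranceModel μ M w₀ ρ u v) : MemLp (fun x => x) ⊤ μ :=
  h.memLp_top_contract isContract_id

theorem integrable_contract (h : IsInsuranceModel μ M w₀ ρ u v) {I : ℝ → ℝ}
    (hI : IsContract M I) : Integrable I μ := integrable_of_memLp_top (h.memLp_top_contract hI)

theorem mean_nonneg (h : IsInsuranceModel μ M w₀ ρ u v) {I : ℝ → ℝ}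
    (hI : IsContract M I) : 0 ≤ ∫ x, I x ∂μ :=
  integral_nonneg_of_ae <| by filter_upwards [h.ae_mem] with x hx using (hI.2 x hx).1

theorem mean_le (h : IsInsuranceModel μ M w₀ ρ u v) {I : ℝ → ℝ}
    (hI : IsContract M I) : ∫ x, I x ∂μ ≤ ∫ x, x ∂μ :=
  integral_mono_ae (h.integrable_contract hI) (h.integrable_contract isContract_id) <| by
    filter_upwards [h.ae_mem] with x hx using (hI.2 x hx).2

/-- The wealth levels that enter the optimality conditions are attainable. -/
theorem sub_mem (h : IsInsuranceModel μ M w₀ ρ u v) {I : ℝ → ℝ} (hI : IsContract M I) {z : ℝ}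
    (hz : z ∈ Icc 0 M) :
    w₀ - (1 + ρ) * (∫ x, I x ∂μ) - z ∈ Icc (w₀ - M - (1 + ρ) * ∫ x, x ∂μ) w₀ := by
  have h1 := mul_nonneg (by linarith [h.loading_nonneg] : 0 ≤ 1 + ρ) (h.mean_nonneg hI)
  have h2 := mul_le_mul_of_nonneg_left (h.mean_le hI)
    (by linarith [h.loading_nonneg] : 0 ≤ 1 + ρ)
  exact ⟨by linarith [hz.2], by linarith [hz.1]⟩

theorem wealth_mem (h : IsInsuranceModel μ M w₀ ρ u v) {I : ℝ → ℝ} (hI : IsContract M I) {x : ℝ}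
    (hx : x ∈ Icc 0 M) : wealth μ w₀ ρ I x ∈ Icc (w₀ - M - (1 + ρ) * ∫ x, x ∂μ) w₀ := by
  have := h.sub_mem hI (z := x - I x)
    ⟨by linarith [(hI.2 x hx).2], by linarith [(hI.2 x hx).1, hx.2]⟩
  rw [wealth]
  convert this using 1
  ring

theorem measurable_wealth {I : ℝ → ℝ} (hI : IsContract M I) : Measurable (wealth μ w₀ ρ I) :=
  ((measurable_const.sub measurable_id).add hI.1).sub_const _

theorem memLp_top_marginal (h : IsInsuranceModel μ M w₀ ρ u v) {W : ℝ → ℝ} (hW : Measurable W) :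
    MemLp (fun x => v (W x)) ⊤ μ := by
  obtain ⟨C, hC⟩ := h.marginal_bounded
  exact memLp_top_of_bound (h.marginal_continuous.measurable.comp hW).aestronglyMeasurable C
    (ae_of_all _ fun x => hC _)

theorem integrable_utility (h : IsInsuranceModel μ M w₀ ρ u v) {W : ℝ → ℝ} (hW : Measurable W) :
    Integrable (fun x => u (W x)) μ := by
  obtain ⟨C, hC⟩ := h.bounded
  obtain ⟨L, hL⟩ := h.lipschitz
  exact .of_bound (hL.continuous.measurable.comp hW).aestronglyMeasurable C
    (ae_of_all _ fun x => hC _)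

theorem memLp_top_gradient (h : IsInsuranceModel μ M w₀ ρ u v) {I : ℝ → ℝ} (hI : IsContract M I) :
    MemLp (gradient μ w₀ ρ v I) ⊤ μ :=
  (h.memLp_top_marginal (measurable_wealth hI)).sub (memLp_const _)

theorem wealth_sub (h : IsInsuranceModel μ M w₀ ρ u v) {I J : ℝ → ℝ} (hI : IsContract M I)
    (hJ : IsContract M J) (x : ℝ) :
    wealth μ w₀ ρ J x - wealth μ w₀ ρ I x = J x - I x - (1 + ρ) * ∫ y, (J y - I y) ∂μ := by
  rw [integral_sub (h.integrable_contract hJ) (h.integrable_contract hI), wealth, wealth]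
  ring

theorem memLp_top_sub (h : IsInsuranceModel μ M w₀ ρ u v) {I J : ℝ → ℝ} (hI : IsContract M I)
    (hJ : IsContract M J) : MemLp (fun x => J x - I x) ⊤ μ :=
  (h.memLp_top_contract hJ).sub (h.memLp_top_contract hI)

theorem memLp_top_wealth_sub (h : IsInsuranceModel μ M w₀ ρ u v) {I J : ℝ → ℝ}
    (hI : IsContract M I) (hJ : IsContract M J) :
    MemLp (fun x => wealth μ w₀ ρ J x - wealth μ w₀ ρ I x) ⊤ μ := by
  simp_rw [h.wealth_sub hI hJ]
  exact (h.memLp_top_sub hI hJ).sub (memLp_const _)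

theorem integral_marginal_mul_wealth_sub (h : IsInsuranceModel μ M w₀ ρ u v) {I J : ℝ → ℝ}
    (hI : IsContract M I) (hJ : IsContract M J) :
    ∫ x, v (wealth μ w₀ ρ I x) * (wealth μ w₀ ρ J x - wealth μ w₀ ρ I x) ∂μ =
      ∫ x, gradient μ w₀ ρ v I x * (J x - I x) ∂μ := by
  have hv := h.memLp_top_marginal (μ := μ) (measurable_wealth (μ := μ) (w₀ := w₀) (ρ := ρ) hI)
  have hd := h.memLp_top_sub hI hJ
  have hvd := integrable_of_memLp_top (memLp_top_mul hv hd)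
  set c := ∫ y, (J y - I y) ∂μ with hc
  set e := ∫ y, v (wealth μ w₀ ρ I y) ∂μ with he
  have e1 : ∀ x, v (wealth μ w₀ ρ I x) * (wealth μ w₀ ρ J x - wealth μ w₀ ρ I x) =
      v (wealth μ w₀ ρ I x) * (J x - I x) - v (wealth μ w₀ ρ I x) * ((1 + ρ) * c) := by
    intro x; rw [h.wealth_sub hI hJ]; ring
  have e2 : ∀ x, gradient μ w₀ ρ v I x * (J x - I x) =
      v (wealth μ w₀ ρ I x) * (J x - I x) - (1 + ρ) * e * (J x - I x) := by
    intro x; rw [gradient]; ring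
  simp_rw [e1, e2]
  rw [integral_sub hvd ((integrable_of_memLp_top hv).mul_const _), integral_mul_const,
    integral_sub hvd ((integrable_of_memLp_top hd).const_mul _), integral_const_mul]
  ring

theorem tangent_le (h : IsInsuranceModel μ M w₀ ρ u v) {a b : ℝ}
    (ha : a ∈ Icc (w₀ - M - (1 + ρ) * ∫ x, x ∂μ) w₀)
    (hb : b ∈ Icc (w₀ - M - (1 + ρ) * ∫ x, x ∂μ) w₀) : u b ≤ u a + v a * (b - a) := by
  rcases eq_or_ne a b with rfl | hab
  · simp
  · exact (h.tangent a ha b hb hab).le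

theorem integrable_tangent (h : IsInsuranceModel μ M w₀ ρ u v) {I J : ℝ → ℝ}
    (hI : IsContract M I) (hJ : IsContract M J) : Integrable (fun x =>
      v (wealth μ w₀ ρ I x) * (wealth μ w₀ ρ J x - wealth μ w₀ ρ I x)) μ :=
  integrable_of_memLp_top (memLp_top_mul (h.memLp_top_marginal (measurable_wealth hI))
    (h.memLp_top_wealth_sub hI hJ))

theorem expectedUtility_le_add_gradient (h : IsInsuranceModel μ M w₀ ρ u v) {I J : ℝ → ℝ}
    (hI : IsContract M I) (hJ : IsContract M J) :
    ∫ x, u (wealth μ w₀ ρ J x) ∂μ ≤ ∫ x, u (wealth μ w₀ ρ I x) ∂μ +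
      ∫ x, gradient μ w₀ ρ v I x * (J x - I x) ∂μ := by
  have h1 := h.integrable_utility (measurable_wealth (μ := μ) (w₀ := w₀) (ρ := ρ) hI)
  rw [← h.integral_marginal_mul_wealth_sub hI hJ, ← integral_add h1 (h.integrable_tangent hI hJ)]
  refine integral_mono_ae (h.integrable_utility (measurable_wealth hJ))
    (h1.add (h.integrable_tangent hI hJ)) ?_
  filter_upwards [h.ae_mem] with x hx
  exact h.tangent_le (h.wealth_mem hI hx) (h.wealth_mem hJ hx)

theorem wealth_ae_eq_of_add_gradient_le (h : IsInsuranceModel μ M w₀ ρ u v) {I J : ℝ → ℝ}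
    (hI : IsContract M I) (hJ : IsContract M J)
    (hle : ∫ x, u (wealth μ w₀ ρ I x) ∂μ + ∫ x, gradient μ w₀ ρ v I x * (J x - I x) ∂μ ≤
      ∫ x, u (wealth μ w₀ ρ J x) ∂μ) : ∀ᵐ x ∂μ, wealth μ w₀ ρ J x = wealth μ w₀ ρ I x := by
  have h1 := h.integrable_utility (measurable_wealth (μ := μ) (w₀ := w₀) (ρ := ρ) hI)
  have h2 := h.integrable_utility (measurable_wealth (μ := μ) (w₀ := w₀) (ρ := ρ) hJ)
  have h3 := h.integrable_tangent hI hJ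
  rw [← h.integral_marginal_mul_wealth_sub hI hJ, ← integral_add h1 h3] at hle
  have hint : ∀ᵐ x ∂μ, u (wealth μ w₀ ρ J x) ≤ u (wealth μ w₀ ρ I x) +
      v (wealth μ w₀ ρ I x) * (wealth μ w₀ ρ J x - wealth μ w₀ ρ I x) := by
    filter_upwards [h.ae_mem] with x hx
    exact h.tangent_le (h.wealth_mem hI hx) (h.wealth_mem hJ hx)
  have heq := (integral_eq_iff_of_ae_le h2 (h1.add h3) hint).1
    (le_antisymm (integral_mono_ae h2 (h1.add h3) hint) hle)
  filter_upwards [heq, h.ae_mem] with x hx hxm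
  by_contra hne
  exact (h.tangent _ (h.wealth_mem hI hxm) _ (h.wealth_mem hJ hxm) (Ne.symm hne)).ne hx

/-- The variance constraint restricts the directions that lead from `I` to a contract of no larger
variance. -/
theorem integral_centered_mul_sub_nonpos (h : IsInsuranceModel μ M w₀ ρ u v) {I J : ℝ → ℝ}
    (hI : IsContract M I) (hJ : IsContract M J) (hv : variance J μ ≤ variance I μ) :
    ∫ x, (I x - ∫ y, I y ∂μ) * (J x - I x) ∂μ ≤ 0 := by
  have := variance_eq_add_cross (memLp_two_of_top (h.memLp_top_contract hI))
    (memLp_two_of_top (h.memLp_top_sub hI hJ))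
  have e : (fun x => I x + (J x - I x)) = J := by ext; ring
  rw [e] at this
  have h0 := variance_nonneg (fun x => J x - I x) μ
  linarith

/-- The first-order (Karush-Kuhn-Tucker) conditions for the multiplier `θ` of half the variance:
the Lagrangian gradient `v(W) - θ I - κ`, with `κ` collecting the constants, is nonpositive, and
vanishes where the indemnity is positive. -/
def IsStationary (μ : Measure ℝ) (w₀ ρ : ℝ) (v : ℝ → ℝ) (θ : ℝ) (I : ℝ → ℝ) : Prop :=
  ∀ᵐ x ∂μ, gradient μ w₀ ρ v I x - θ * (I x - ∫ y, I y ∂μ) ≤ 0 ∧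
    (I x ≠ 0 → gradient μ w₀ ρ v I x - θ * (I x - ∫ y, I y ∂μ) = 0)

theorem integral_gradient_mul_sub_nonpos (h : IsInsuranceModel μ M w₀ ρ u v) {I J : ℝ → ℝ}
    {θ : ℝ} (hθ : 0 ≤ θ) (hI : IsContract M I) (hs : IsStationary μ w₀ ρ v θ I)
    (hJ : IsContract M J) (hv : variance J μ ≤ variance I μ) :
    ∫ x, gradient μ w₀ ρ v I x * (J x - I x) ∂μ ≤ 0 := by
  have hd := h.memLp_top_sub hI hJ
  have hc : MemLp (fun x => I x - ∫ y, I y ∂μ) ⊤ μ :=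
    (h.memLp_top_contract hI).sub (memLp_const _)
  have h1 : ∫ x, (gradient μ w₀ ρ v I x * (J x - I x) -
      θ * ((I x - ∫ y, I y ∂μ) * (J x - I x))) ∂μ ≤ 0 := by
    refine integral_nonpos_of_ae ?_
    filter_upwards [hs, h.ae_mem] with x hx hxm
    rw [← mul_assoc, ← sub_mul]
    by_cases h0 : I x = 0
    · have := (hJ.2 x hxm).1
      exact mul_nonpos_of_nonpos_of_nonneg hx.1 (by rw [h0]; linarith)
    · rw [hx.2 h0, zero_mul]; rfl
  rw [integral_sub (integrable_of_memLp_top (memLp_top_mul (h.memLp_top_gradient hI) hd))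
    ((integrable_of_memLp_top (memLp_top_mul hc hd)).const_mul θ), integral_const_mul] at h1
  have h2 := mul_nonpos_of_nonneg_of_nonpos hθ (h.integral_centered_mul_sub_nonpos hI hJ hv)
  linarith

theorem expectedUtility_le_of_isStationary (h : IsInsuranceModel μ M w₀ ρ u v) {I J : ℝ → ℝ}
    {θ : ℝ} (hθ : 0 ≤ θ) (hI : IsContract M I) (hs : IsStationary μ w₀ ρ v θ I)
    (hJ : IsContract M J) (hv : variance J μ ≤ variance I μ) :
    ∫ x, u (wealth μ w₀ ρ J x) ∂μ ≤ ∫ x, u (wealth μ w₀ ρ I x) ∂μ := by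
  have h1 := h.expectedUtility_le_add_gradient hI hJ
  have h2 := h.integral_gradient_mul_sub_nonpos hθ hI hs hJ hv
  linarith

/-- Equal wealth means that the indemnities differ by a constant, and the constant vanishes, since
both indemnities are small at small losses. -/
theorem ae_eq_of_isStationary (h : IsInsuranceModel μ M w₀ ρ u v) {I J : ℝ → ℝ}
    {θ : ℝ} (hθ : 0 ≤ θ) (hI : IsContract M I) (hs : IsStationary μ w₀ ρ v θ I)
    (hJ : IsContract M J) (hv : variance J μ ≤ variance I μ)
    (hle : ∫ x, u (wealth μ w₀ ρ I x) ∂μ ≤ ∫ x, u (wealth μ w₀ ρ J x) ∂μ) :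
    ∀ᵐ x ∂μ, J x = I x := by
  have h2 := h.integral_gradient_mul_sub_nonpos hθ hI hs hJ hv
  have h3 := h.wealth_ae_eq_of_add_gradient_le hI hJ (by linarith)
  set c := (1 + ρ) * ∫ y, (J y - I y) ∂μ with hc
  have h4 : ∀ᵐ x ∂μ, J x - I x = c := by
    filter_upwards [h3] with x hx
    have := h.wealth_sub hI hJ x
    rw [hx, sub_self] at this
    linarith
  have hc0 : c = 0 := by
    by_contra hne
    have hpos : 0 < min |c| M := lt_min (abs_pos.2 hne) h.sup_pos
    obtain ⟨x, hx, hxc⟩ := h.exists_mem_Ioo_of_ae le_rfl hpos (min_le_right _ _) h4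
    have hxm : x ∈ Icc 0 M := ⟨hx.1.le, hx.2.le.trans (min_le_right _ _)⟩
    have h5 : |J x - I x| ≤ x := by
      rw [abs_le]
      constructor <;> linarith [hI.2 x hxm, hJ.2 x hxm]
    rw [hxc] at h5
    exact absurd (hx.2.trans_le (min_le_left _ _)) (not_lt.2 h5)
  filter_upwards [h4] with x hx
  linarith

/-! ### Existence of an optimal contract -/

theorem isContract_convexComb {I J : ℝ → ℝ} (hI : IsContract M I) (hJ : IsContract M J) {a b : ℝ}
    (ha : 0 ≤ a) (hb : 0 ≤ b) (hab : a + b = 1) : IsContract M (fun x => a * I x + b * J x) := by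
  refine ⟨(hI.1.const_mul a).add (hJ.1.const_mul b), fun x hx => ⟨?_, ?_⟩⟩
  · have := mul_nonneg ha (hI.2 x hx).1
    have := mul_nonneg hb (hJ.2 x hx).1
    linarith
  · have h1 := mul_le_mul_of_nonneg_left (hI.2 x hx).2 ha
    have h2 := mul_le_mul_of_nonneg_left (hJ.2 x hx).2 hb
    have h3 : a * x + b * x = x := by rw [← add_mul, hab, one_mul]
    linarith

theorem wealth_congr {I J : ℝ → ℝ} (hIJ : I =ᵐ[μ] J) :
    wealth μ w₀ ρ I =ᵐ[μ] wealth μ w₀ ρ J := by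
  filter_upwards [hIJ] with x hx
  rw [wealth, wealth, hx, integral_congr_ae hIJ]

theorem integral_comp_wealth_congr {I J : ℝ → ℝ} (hIJ : I =ᵐ[μ] J) :
    ∫ x, u (wealth μ w₀ ρ I x) ∂μ = ∫ x, u (wealth μ w₀ ρ J x) ∂μ :=
  integral_congr_ae <| by filter_upwards [wealth_congr hIJ] with x hx using by rw [hx]

theorem expectedUtility_convexComb (h : IsInsuranceModel μ M w₀ ρ u v) {I J : ℝ → ℝ}
    (hI : IsContract M I) (hJ : IsContract M J) {a b : ℝ}
    (ha : 0 ≤ a) (hb : 0 ≤ b) (hab : a + b = 1) :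
    a * ∫ x, u (wealth μ w₀ ρ I x) ∂μ + b * ∫ x, u (wealth μ w₀ ρ J x) ∂μ ≤
      ∫ x, u (wealth μ w₀ ρ (fun x => a * I x + b * J x) x) ∂μ := by
  set C : ℝ → ℝ := fun x => a * I x + b * J x with hCdef
  have hC : IsContract M C := isContract_convexComb hI hJ ha hb hab
  have hi : ∀ {J}, IsContract M J → Integrable (fun x => gradient μ w₀ ρ v C x * (J x - C x)) μ :=
    fun hJ => integrable_of_memLp_top (memLp_top_mul (h.memLp_top_gradient hC)
      (h.memLp_top_sub hC hJ))
  have h1 := mul_le_mul_of_nonneg_left (h.expectedUtility_le_add_gradient hC hI) ha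
  have h2 := mul_le_mul_of_nonneg_left (h.expectedUtility_le_add_gradient hC hJ) hb
  have h3 : a * ∫ x, gradient μ w₀ ρ v C x * (I x - C x) ∂μ +
      b * ∫ x, gradient μ w₀ ρ v C x * (J x - C x) ∂μ = 0 := by
    rw [← integral_const_mul, ← integral_const_mul,
      ← integral_add ((hi hI).const_mul a) ((hi hJ).const_mul b)]
    refine integral_eq_zero_of_ae (ae_of_all _ fun x => ?_)
    obtain rfl : b = 1 - a := by linarith
    simp only [hCdef, Pi.zero_apply]
    ring
  have h4 : ∀ t : ℝ, a * t + b * t = t := fun t => by rw [← add_mul, hab, one_mul]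
  have := h4 (∫ x, u (wealth μ w₀ ρ C x) ∂μ)
  linarith

/-- The truncation of a function to the range `[0, x]` of indemnities. -/
def truncate (f : ℝ → ℝ) (x : ℝ) : ℝ := max 0 (min x (f x))

theorem isContract_truncate {f : ℝ → ℝ} (hf : Measurable f) : IsContract M (truncate f) :=
  ⟨measurable_const.max (measurable_id.min hf), fun _ hx =>
    ⟨le_max_left _ _, max_le hx.1 (min_le_left _ _)⟩⟩

theorem truncate_ae_eq {f : ℝ → ℝ} (h0 : 0 ≤ᵐ[μ] f) (h1 : f ≤ᵐ[μ] fun x => x) :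
    truncate f =ᵐ[μ] f := by
  filter_upwards [h0, h1] with x hx0 hx1
  rw [truncate, min_eq_right hx1]
  exact max_eq_right hx0

theorem integral_abs_le_norm (f : Lp ℝ 2 μ) : ∫ x, |f x| ∂μ ≤ ‖f‖ := by
  have h0 := variance_nonneg (fun x => |f x|) μ
  rw [variance_eq_sub (X := fun x => |f x|) (Lp.memLp f).abs] at h0
  have h1 : ‖f‖ ^ 2 = ∫ x, f x ^ 2 ∂μ := by
    rw [← real_inner_self_eq_norm_sq, L2.inner_def]
    congr 1; ext x; simp [sq]
  simp only [Pi.pow_apply, sq_abs] at h0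
  exact le_of_sq_le_sq (by linarith) (norm_nonneg f)

theorem continuous_expectedUtility_Lp (h : IsInsuranceModel μ M w₀ ρ u v) :
    Continuous fun f : Lp ℝ 2 μ => ∫ x, u (wealth μ w₀ ρ f x) ∂μ := by
  obtain ⟨C, hC⟩ := h.lipschitz
  have hmeas : ∀ f : Lp ℝ 2 μ, Measurable (wealth μ w₀ ρ f) := fun f =>
    ((measurable_const.sub measurable_id).add (Lp.stronglyMeasurable f).measurable).sub_const _
  have hint : ∀ f : Lp ℝ 2 μ, Integrable f μ := fun f => (Lp.memLp f).integrable one_le_two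
  have hρ := h.loading_nonneg
  refine (LipschitzWith.of_dist_le' (K := C * (2 + ρ)) fun f g => ?_).continuous
  have hfg := Lp.coeFn_sub f g
  set δ := ∫ x, |(f - g : Lp ℝ 2 μ) x| ∂μ with hδ
  have hδle : δ ≤ ‖f - g‖ := integral_abs_le_norm _
  have hmean : |∫ x, f x ∂μ - ∫ x, g x ∂μ| ≤ δ := by
    rw [← integral_sub (hint f) (hint g)]
    refine (abs_integral_le_integral_abs).trans_eq (integral_congr_ae ?_)
    filter_upwards [hfg] with x hx
    rw [hx, Pi.sub_apply]
  rw [Real.dist_eq, dist_eq_norm,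
    ← integral_sub (h.integrable_utility (hmeas f)) (h.integrable_utility (hmeas g))]
  refine abs_integral_le_integral_abs.trans ?_
  have hia : Integrable (fun x => |(f - g : Lp ℝ 2 μ) x|) μ := (hint (f - g)).abs
  have hb : ∫ x, |u (wealth μ w₀ ρ f x) - u (wealth μ w₀ ρ g x)| ∂μ ≤
      ∫ x, (C : ℝ) * (|(f - g : Lp ℝ 2 μ) x| + (1 + ρ) * δ) ∂μ := by
    refine integral_mono_ae ((h.integrable_utility (hmeas f)).sub
      (h.integrable_utility (hmeas g))).abs ((hia.add (integrable_const _)).const_mul _) ?_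
    filter_upwards [hfg] with x hx
    have h1 := hC.dist_le_mul (wealth μ w₀ ρ f x) (wealth μ w₀ ρ g x)
    rw [Real.dist_eq, Real.dist_eq] at h1
    refine h1.trans (mul_le_mul_of_nonneg_left ?_ C.2)
    rw [hx, Pi.sub_apply]
    have e : wealth μ w₀ ρ f x - wealth μ w₀ ρ g x =
        (f x - g x) - (1 + ρ) * (∫ x, f x ∂μ - ∫ x, g x ∂μ) := by
      rw [wealth, wealth]; ring
    rw [e]
    refine (abs_sub _ _).trans (add_le_add_right ?_ _)
    rw [abs_mul, abs_of_nonneg (by linarith : 0 ≤ 1 + ρ)]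
    exact mul_le_mul_of_nonneg_left hmean (by linarith)
  refine hb.trans ?_
  rw [integral_const_mul, integral_add hia (integrable_const _), integral_const]
  simp only [probReal_univ, one_smul]
  rw [← hδ, mul_assoc]
  exact mul_le_mul_of_nonneg_left (by nlinarith) C.2

/-- The map `f ↦ f - 𝔼[f]` on `L²`. -/
noncomputable def center (μ : Measure ℝ) [IsProbabilityMeasure μ] : Lp ℝ 2 μ →L[ℝ] Lp ℝ 2 μ :=
  ContinuousLinearMap.id ℝ _ -
    (innerSL ℝ (Lp.const 2 μ (1 : ℝ))).smulRight (Lp.const 2 μ (1 : ℝ))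

theorem norm_center_sq (f : Lp ℝ 2 μ) : ‖center μ f‖ ^ 2 = variance f μ := by
  have h1 := Lp.coeFn_const (p := 2) (μ := μ) (1 : ℝ)
  have h2 : inner ℝ (Lp.const 2 μ (1 : ℝ)) f = ∫ x, f x ∂μ := by
    rw [L2.inner_def]
    refine integral_congr_ae ?_
    filter_upwards [h1] with x hx
    rw [hx]
    simp
  have h3 : center μ f =ᵐ[μ] fun x => f x - ∫ y, f y ∂μ := by
    have e : center μ f = f - (∫ y, f y ∂μ) • Lp.const 2 μ (1 : ℝ) := by
      rw [← h2]; rfl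
    rw [e]
    filter_upwards [Lp.coeFn_sub f ((∫ y, f y ∂μ) • Lp.const 2 μ (1 : ℝ)),
      Lp.coeFn_smul (∫ y, f y ∂μ) (Lp.const 2 μ (1 : ℝ)), h1] with x hx1 hx2 hx3
    rw [hx1, Pi.sub_apply, hx2, Pi.smul_apply, hx3]
    simp
  rw [← real_inner_self_eq_norm_sq, L2.inner_def,
    variance_eq_integral (Lp.memLp f).1.aemeasurable]
  refine integral_congr_ae ?_
  filter_upwards [h3] with x hx
  rw [hx]
  simp [sq]

/-- `I` maximizes the expected utility among the contracts of variance at most `ν`. -/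
def IsMaximizer (μ : Measure ℝ) (M w₀ ρ : ℝ) (u : ℝ → ℝ) (ν : ℝ) (I : ℝ → ℝ) : Prop :=
  IsContract M I ∧ variance I μ ≤ ν ∧ ∀ J, IsContract M J → variance J μ ≤ ν →
    ∫ x, u (wealth μ w₀ ρ J x) ∂μ ≤ ∫ x, u (wealth μ w₀ ρ I x) ∂μ

theorem exists_optimal (h : IsInsuranceModel μ M w₀ ρ u v) {ν : ℝ} (hν : 0 ≤ ν) :
    ∃ I, IsMaximizer μ M w₀ ρ u ν I := by
  have hid2 : MemLp (fun x : ℝ => x) 2 μ := memLp_two_of_top h.memLp_top_id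
  set xid : Lp ℝ 2 μ := hid2.toLp _ with hxid
  have hxe : xid =ᵐ[μ] fun x => x := hid2.coeFn_toLp
  set K : Set (Lp ℝ 2 μ) := Icc 0 xid ∩ center μ ⁻¹' Metric.closedBall 0 (√ν) with hK
  have hvar : ∀ f : Lp ℝ 2 μ, center μ f ∈ Metric.closedBall 0 (√ν) ↔ variance f μ ≤ ν := by
    intro f
    rw [mem_closedBall_zero_iff, ← norm_center_sq, Real.le_sqrt (norm_nonneg _) hν]
  have hrange : ∀ f ∈ Icc 0 xid, 0 ≤ᵐ[μ] f ∧ f ≤ᵐ[μ] fun x => x := by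
    intro f hf
    refine ⟨?_, ?_⟩
    · exact (Lp.coeFn_nonneg f).2 hf.1
    · exact ((Lp.coeFn_le f xid).2 hf.2).trans hxe.le
  have htr : ∀ f ∈ K, truncate f =ᵐ[μ] f := fun f hf =>
    truncate_ae_eq (hrange f hf.1).1 (hrange f hf.1).2
  have hctr : ∀ f : Lp ℝ 2 μ, IsContract M (truncate f) := fun f =>
    isContract_truncate (Lp.stronglyMeasurable f).measurable
  have hmemK : ∀ J, IsContract M J → variance J μ ≤ ν → ∃ f ∈ K, f =ᵐ[μ] J := by
    intro J hJ hv
    have hJ2 := memLp_two_of_top (h.memLp_top_contract hJ)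
    have hJe := hJ2.coeFn_toLp
    refine ⟨hJ2.toLp J, ⟨⟨?_, ?_⟩, (hvar _).2 ?_⟩, hJe⟩
    · rw [← Lp.coeFn_nonneg]
      filter_upwards [hJe, h.ae_mem] with x hx hxm
      rw [hx]; exact (hJ.2 x hxm).1
    · rw [← Lp.coeFn_le]
      filter_upwards [hJe, hxe, h.ae_mem] with x hx hx' hxm
      rw [hx, hx']; exact (hJ.2 x hxm).2
    · rwa [variance_congr hJe]
  obtain ⟨f0, hf0, -⟩ := hmemK _ isContract_zero
    ((variance_zero μ).trans_le hν)
  have : PosSMulMono ℝ (Lp ℝ 2 μ) := .of_smul_nonneg fun a ha f hf => by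
    rw [← Lp.coeFn_nonneg] at hf ⊢
    filter_upwards [hf, Lp.coeFn_smul a f] with x hx hx'
    rw [hx']
    exact mul_nonneg ha hx
  have hconvK : Convex ℝ K :=
    (convex_Icc _ _).inter ((convex_closedBall _ _).linear_preimage (center μ).toLinearMap)
  have hΦ : ConcaveOn ℝ K fun f : Lp ℝ 2 μ => ∫ x, u (wealth μ w₀ ρ f x) ∂μ := by
    refine ⟨hconvK, fun f hf g hg a b ha hb hab => ?_⟩
    simp only [smul_eq_mul]
    rw [← integral_comp_wealth_congr (htr f hf), ← integral_comp_wealth_congr (htr g hg)]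
    refine (h.expectedUtility_convexComb (hctr f) (hctr g) ha hb hab).trans_eq
      (integral_comp_wealth_congr ?_)
    filter_upwards [htr f hf, htr g hg, Lp.coeFn_add (a • f) (b • g), Lp.coeFn_smul a f,
      Lp.coeFn_smul b g] with x h1 h2 h3 h4 h5
    rw [h1, h2, h3, Pi.add_apply, h4, h5, Pi.smul_apply, Pi.smul_apply, smul_eq_mul, smul_eq_mul]
  obtain ⟨B, hB⟩ := h.bounded
  have hbdd : Bornology.IsBounded K := by
    refine (isBounded_iff_forall_norm_le.2 ⟨‖xid‖, fun f hf => ?_⟩).subset inter_subset_left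
    refine norm_le_norm_of_abs_le_abs ?_
    rw [abs_of_nonneg hf.1, abs_of_nonneg (hf.1.trans hf.2)]
    exact hf.2
  have hsup : BddAbove ((fun f : Lp ℝ 2 μ => ∫ x, u (wealth μ w₀ ρ f x) ∂μ) '' K) := by
    refine ⟨B, ?_⟩
    rintro _ ⟨f, -, rfl⟩
    have := norm_integral_le_of_norm_le_const (μ := μ) (f := fun x => u (wealth μ w₀ ρ f x)) (C := B)
      (ae_of_all _ fun x => hB _)
    rw [probReal_univ, mul_one] at this
    exact (le_abs_self _).trans this
  obtain ⟨f, hf, hfmax⟩ := exists_forall_le_of_concaveOn (K := K) ⟨f0, hf0⟩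
    (isClosed_Icc.inter (Metric.isClosed_closedBall.preimage (center μ).continuous))
    hbdd hΦ h.continuous_expectedUtility_Lp hsup
  refine ⟨truncate f, hctr f, ?_, fun J hJ hv => ?_⟩
  · rw [variance_congr (htr f hf)]
    exact (hvar f).1 hf.2
  · obtain ⟨g, hg, hgJ⟩ := hmemK J hJ hv
    rw [integral_comp_wealth_congr (htr f hf), ← integral_comp_wealth_congr hgJ]
    exact hfmax g hg

/-! ### Necessary first-order conditions -/

theorem variance_convexComb (h : IsInsuranceModel μ M w₀ ρ u v) {I J : ℝ → ℝ}
    (hI : IsContract M I) (hJ : IsContract M J) (t : ℝ) :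
    variance (fun x => (1 - t) * I x + t * J x) μ = variance I μ +
      t * (2 * (∫ x, (I x - ∫ y, I y ∂μ) * (J x - I x) ∂μ) +
        t * variance (fun x => J x - I x) μ) := by
  have h1 := variance_eq_add_cross (memLp_two_of_top (h.memLp_top_contract hI))
    (memLp_two_of_top ((h.memLp_top_sub hI hJ).const_mul t))
  have e1 : (fun x => I x + t * (J x - I x)) = fun x => (1 - t) * I x + t * J x := by
    ext x; ring
  have e2 : ∀ x, (I x - ∫ y, I y ∂μ) * (t * (J x - I x)) =
      t * ((I x - ∫ y, I y ∂μ) * (J x - I x)) := fun x => by ring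
  simp_rw [e1, e2] at h1
  rw [integral_const_mul, variance_const_mul] at h1
  rw [h1]; ring

theorem IsMaximizer.integral_gradient_mul_sub_nonpos (h : IsInsuranceModel μ M w₀ ρ u v)
    {ν : ℝ} {I J : ℝ → ℝ} (hI : IsMaximizer μ M w₀ ρ u ν I) (hJ : IsContract M J)
    (hfeas : ∀ᶠ t in 𝓝[>] (0 : ℝ), variance (fun x => (1 - t) * I x + t * J x) μ ≤ ν) :
    ∫ x, gradient μ w₀ ρ v I x * (J x - I x) ∂μ ≤ 0 := by
  set Δ : ℝ → ℝ := fun x => wealth μ w₀ ρ J x - wealth μ w₀ ρ I x with hΔdef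
  have hΔ : MemLp Δ ⊤ μ := h.memLp_top_wealth_sub hI.1 hJ
  have hmW := measurable_wealth (μ := μ) (w₀ := w₀) (ρ := ρ) hI.1
  have hmΔ : Measurable Δ := (measurable_wealth hJ).sub (measurable_wealth hI.1)
  rw [← h.integral_marginal_mul_wealth_sub hI.1 hJ]
  have hlim : Tendsto (fun t : ℝ => ∫ x, v (wealth μ w₀ ρ I x + t * Δ x) * Δ x ∂μ) (𝓝[>] 0)
      (𝓝 (∫ x, v (wealth μ w₀ ρ I x) * Δ x ∂μ)) := by
    obtain ⟨C, hC⟩ := h.marginal_bounded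
    refine tendsto_integral_filter_of_dominated_convergence (fun x => C * |Δ x|) ?_ ?_ ?_ ?_
    · exact Eventually.of_forall fun t => ((h.marginal_continuous.measurable.comp
        (hmW.add (hmΔ.const_mul t))).mul hmΔ).aestronglyMeasurable
    · refine Eventually.of_forall fun t => ae_of_all _ fun x => ?_
      rw [Real.norm_eq_abs, abs_mul]
      exact mul_le_mul_of_nonneg_right (hC _) (abs_nonneg _)
    · exact (integrable_of_memLp_top hΔ).abs.const_mul C
    · refine ae_of_all _ fun x => ?_
      have hc : Continuous fun t : ℝ => v (wealth μ w₀ ρ I x + t * Δ x) * Δ x :=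
        (h.marginal_continuous.comp (by fun_prop)).mul_const _
      have := (hc.tendsto 0).mono_left (nhdsWithin_le_nhds (s := Ioi 0))
      simpa using this
  refine le_of_tendsto hlim ?_
  filter_upwards [hfeas, Ioo_mem_nhdsGT (zero_lt_one (α := ℝ))] with t ht ht1
  set It : ℝ → ℝ := fun x => (1 - t) * I x + t * J x with hIt
  have hItc : IsContract M It :=
    isContract_convexComb hI.1 hJ (by linarith [ht1.2]) ht1.1.le (by ring)
  have hWt : ∀ x, wealth μ w₀ ρ It x = wealth μ w₀ ρ I x + t * Δ x := by
    intro x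
    have : ∫ y, It y ∂μ = (1 - t) * ∫ y, I y ∂μ + t * ∫ y, J y ∂μ := by
      rw [← integral_const_mul, ← integral_const_mul, ← integral_add
        ((h.integrable_contract hI.1).const_mul _) ((h.integrable_contract hJ).const_mul _)]
    simp only [hΔdef, wealth]
    rw [this]
    simp only [hIt]
    ring
  have h1 := h.expectedUtility_le_add_gradient hItc hI.1
  have h2 := hI.2.2 It hItc ht
  rw [← h.integral_marginal_mul_wealth_sub hItc hI.1] at h1
  have e : ∀ x, v (wealth μ w₀ ρ It x) * (wealth μ w₀ ρ I x - wealth μ w₀ ρ It x) =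
      -t * (v (wealth μ w₀ ρ I x + t * Δ x) * Δ x) := fun x => by rw [hWt]; ring
  simp_rw [e] at h1
  rw [integral_const_mul] at h1
  by_contra! hpos
  have := mul_pos ht1.1 hpos
  linarith

theorem IsMaximizer.exists_multiplier (h : IsInsuranceModel μ M w₀ ρ u v) {ν : ℝ} (hν : 0 < ν)
    {I : ℝ → ℝ} (hI : IsMaximizer μ M w₀ ρ u ν I) :
    ∃ θ : ℝ, 0 ≤ θ ∧ (θ = 0 ∨ variance I μ = ν) ∧ ∀ J, IsContract M J →
      ∫ x, gradient μ w₀ ρ v I x * (J x - I x) ∂μ ≤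
        θ * ∫ x, (I x - ∫ y, I y ∂μ) * (J x - I x) ∂μ := by
  have hlim : ∀ J : ℝ → ℝ, Tendsto (fun t : ℝ => 2 * (∫ x, (I x - ∫ y, I y ∂μ) * (J x - I x) ∂μ) +
      t * variance (fun x => J x - I x) μ) (𝓝[>] 0)
      (𝓝 (2 * ∫ x, (I x - ∫ y, I y ∂μ) * (J x - I x) ∂μ)) := fun J => by
    have hc : Continuous fun t : ℝ => 2 * (∫ x, (I x - ∫ y, I y ∂μ) * (J x - I x) ∂μ) +
      t * variance (fun x => J x - I x) μ := by fun_prop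
    simpa using (hc.tendsto 0).mono_left (nhdsWithin_le_nhds (s := Ioi 0))
  rcases hI.2.1.lt_or_eq with hlt | heq
  · refine ⟨0, le_rfl, Or.inl rfl, fun J hJ => ?_⟩
    rw [zero_mul]
    refine hI.integral_gradient_mul_sub_nonpos h hJ ?_
    have h1 : Tendsto (fun t : ℝ => variance I μ +
        t * (2 * (∫ x, (I x - ∫ y, I y ∂μ) * (J x - I x) ∂μ) +
        t * variance (fun x => J x - I x) μ)) (𝓝[>] 0) (𝓝 (variance I μ + 0 *
          (2 * ∫ x, (I x - ∫ y, I y ∂μ) * (J x - I x) ∂μ))) :=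
      tendsto_const_nhds.add ((tendsto_id.mono_right nhdsWithin_le_nhds).mul (hlim J))
    rw [zero_mul, add_zero] at h1
    filter_upwards [h1.eventually_lt_const hlt] with t ht
    rw [h.variance_convexComb hI.1 hJ]
    exact ht.le
  · set A : (ℝ → ℝ) → ℝ := fun J => ∫ x, (I x - ∫ y, I y ∂μ) * (J x - I x) ∂μ with hA
    set B : (ℝ → ℝ) → ℝ := fun J => ∫ x, gradient μ w₀ ρ v I x * (J x - I x) ∂μ with hB
    have hlin : ∀ f : ℝ → ℝ, MemLp f ⊤ μ → ∀ J K, IsContract M J → IsContract M K →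
        ∀ a b : ℝ, a + b = 1 → ∫ x, f x * (a * J x + b * K x - I x) ∂μ =
          a * ∫ x, f x * (J x - I x) ∂μ + b * ∫ x, f x * (K x - I x) ∂μ := by
      intro f hf J K hJ hK a b hab
      have hi : ∀ {J}, IsContract M J → Integrable (fun x => f x * (J x - I x)) μ :=
        fun hJ => integrable_of_memLp_top (memLp_top_mul hf (h.memLp_top_sub hI.1 hJ))
      rw [← integral_const_mul, ← integral_const_mul,
        ← integral_add ((hi hJ).const_mul a) ((hi hK).const_mul b)]
      congr 1; ext x
      obtain rfl : b = 1 - a := by linarith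
      ring
    suffices hsep : ∃ θ : ℝ, 0 ≤ θ ∧
        ∀ p ∈ (fun J => (A J, B J)) '' {J | IsContract M J}, p.2 ≤ θ * p.1 by
      obtain ⟨θ, hθ, hmul⟩ := hsep
      exact ⟨θ, hθ, Or.inr heq, fun J hJ => hmul _ ⟨J, hJ, rfl⟩⟩
    refine exists_slope_of_convex ?_ ?_ ?_
    · rintro _ ⟨J, hJ, rfl⟩ _ ⟨K, hK, rfl⟩ a b ha hb hab
      refine ⟨fun x => a * J x + b * K x, isContract_convexComb hJ hK ha hb hab, ?_⟩
      ext
      · exact hlin _ ((h.memLp_top_contract hI.1).sub (memLp_const _)) J K hJ hK a b hab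
      · exact hlin _ (h.memLp_top_gradient hI.1) J K hJ hK a b hab
    · rintro _ ⟨J, hJ, rfl⟩ hneg
      refine hI.integral_gradient_mul_sub_nonpos h hJ ?_
      filter_upwards [(hlim J).eventually_lt_const (show _ < (0 : ℝ) by
        simp only [hA] at hneg; linarith), self_mem_nhdsWithin] with t ht ht0
      rw [h.variance_convexComb hI.1 hJ, heq]
      have := mul_neg_of_pos_of_neg ht0 ht
      linarith
    · -- the direction towards no insurance reduces the variance
      refine ⟨_, ⟨fun _ => 0, isContract_zero, rfl⟩, ?_⟩
      have h1 := h.variance_convexComb hI.1 isContract_zero 1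
      have e1 : (fun x => (1 - 1) * I x + 1 * (0 : ℝ)) = 0 := by ext; simp
      have e2 : (fun x => 0 - I x) = fun x => (-1) * I x := by ext; simp
      rw [e1, variance_zero, e2, variance_const_mul, heq] at h1
      simp only [hA]
      linarith

theorem IsMaximizer.exists_lagrangian_sign (h : IsInsuranceModel μ M w₀ ρ u v) {ν : ℝ}
    (hν : 0 < ν) {I : ℝ → ℝ} (hI : IsMaximizer μ M w₀ ρ u ν I) :
    ∃ θ : ℝ, 0 ≤ θ ∧ (θ = 0 ∨ variance I μ = ν) ∧ ∀ᵐ x ∂μ,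
      (0 < gradient μ w₀ ρ v I x - θ * (I x - ∫ y, I y ∂μ) → I x = x) ∧
      (gradient μ w₀ ρ v I x - θ * (I x - ∫ y, I y ∂μ) < 0 → I x = 0) := by
  obtain ⟨θ, hθ, hslack, hmul⟩ := hI.exists_multiplier h hν
  refine ⟨θ, hθ, hslack, ?_⟩
  set G : ℝ → ℝ := fun x => gradient μ w₀ ρ v I x - θ * (I x - ∫ y, I y ∂μ) with hG
  have hGm : Measurable G := ((h.marginal_continuous.measurable.comp
    (measurable_wealth hI.1)).sub_const _).sub ((hI.1.1.sub_const _).const_mul θ)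
  have hc : MemLp (fun x => I x - ∫ y, I y ∂μ) ⊤ μ :=
    (h.memLp_top_contract hI.1).sub (memLp_const _)
  have hGb : MemLp G ⊤ μ := (h.memLp_top_gradient hI.1).sub (hc.const_mul θ)
  -- full insurance where the Lagrangian gradient is positive, none where it is negative
  set J : ℝ → ℝ := fun x => if 0 < G x then x else if G x < 0 then 0 else I x with hJdef
  have hJ : IsContract M J := by
    refine ⟨Measurable.ite (measurableSet_lt measurable_const hGm) measurable_id
      (Measurable.ite (measurableSet_lt hGm measurable_const) measurable_const hI.1.1),
      fun x hx => ?_⟩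
    simp only [hJdef]
    split_ifs
    · exact ⟨hx.1, le_rfl⟩
    · exact ⟨le_rfl, hx.1⟩
    · exact hI.1.2 x hx
  have hd := h.memLp_top_sub hI.1 hJ
  have hle : ∫ x, G x * (J x - I x) ∂μ ≤ 0 := by
    have e : ∀ x, G x * (J x - I x) = gradient μ w₀ ρ v I x * (J x - I x) -
        θ * ((I x - ∫ y, I y ∂μ) * (J x - I x)) := fun x => by simp only [hG]; ring
    simp_rw [e]
    rw [integral_sub (integrable_of_memLp_top (memLp_top_mul (h.memLp_top_gradient hI.1) hd))
      ((integrable_of_memLp_top (memLp_top_mul hc hd)).const_mul θ), integral_const_mul]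
    linarith [hmul J hJ]
  have hnn : 0 ≤ᵐ[μ] fun x => G x * (J x - I x) := by
    filter_upwards [h.ae_mem] with x hx
    have hIx := hI.1.2 x hx
    simp only [hJdef, Pi.zero_apply]
    split_ifs with h1 h2
    · exact mul_nonneg h1.le (by linarith)
    · exact mul_nonneg_of_nonpos_of_nonpos h2.le (by linarith)
    · simp
  have hzero := (integral_eq_zero_iff_of_nonneg_ae hnn
    (integrable_of_memLp_top (memLp_top_mul hGb hd))).1 (le_antisymm hle (integral_nonneg_of_ae hnn))
  filter_upwards [hzero] with x hx
  simp only [hJdef, Pi.zero_apply, mul_eq_zero] at hx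
  refine ⟨fun hp => ?_, fun hn => ?_⟩
  · rw [if_pos hp] at hx
    rcases hx with hx | hx
    · exact absurd hx hp.ne'
    · linarith
  · rw [if_neg (not_lt.2 hn.le), if_pos hn] at hx
    rcases hx with hx | hx
    · exact absurd hx hn.ne
    · linarith

end IsInsuranceModel

/-! ### Coinsurance above a deductible -/

/-- The indemnities that the first-order conditions describe, in terms of the wealth level `a` net
of the premium, the deductible `d`, and the multiplier `θ`. They interpolate between `(x - d)₊`,
which is the case `θ = 0`, and no insurance. -/
def IsCoinsurance (v : ℝ → ℝ) (M θ a d : ℝ) (I : ℝ → ℝ) : Prop :=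
  (∀ x ∈ Icc 0 d, I x = 0) ∧
    ∀ x ∈ Ioc d M, I x ∈ Ioc 0 (x - d) ∧ v (a - x + I x) - θ * I x = v (a - d)

section Coinsurance

variable {v : ℝ → ℝ} {M θ a d : ℝ} {I J : ℝ → ℝ}

theorem strictAntiOn_marginal_sub (hanti : StrictAntiOn v (Icc (a - M) a)) (hθ : 0 ≤ θ) {x : ℝ}
    (hx : x ≤ M) : StrictAntiOn (fun y => v (a - x + y) - θ * y) (Icc 0 x) := by
  intro y hy z hz hyz
  have h1 := hanti (a := a - x + y) (b := a - x + z) ⟨by linarith [hy.1], by linarith [hy.2]⟩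
    ⟨by linarith [hz.1], by linarith [hz.2]⟩ (by linarith)
  have h2 := mul_le_mul_of_nonneg_left hyz.le hθ
  simp only
  linarith

theorem IsCoinsurance.eqOn (hI : IsCoinsurance v M θ a d I) (hJ : IsCoinsurance v M θ a d J)
    (hanti : StrictAntiOn v (Icc (a - M) a)) (hθ : 0 ≤ θ) (hd : 0 ≤ d) :
    ∀ x ∈ Icc 0 M, I x = J x := by
  intro x hx
  rcases le_or_gt x d with hxd | hxd
  · rw [hI.1 x ⟨hx.1, hxd⟩, hJ.1 x ⟨hx.1, hxd⟩]
  · have h1 := hI.2 x ⟨hxd, hx.2⟩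
    have h2 := hJ.2 x ⟨hxd, hx.2⟩
    exact (strictAntiOn_marginal_sub hanti hθ hx.2).injOn ⟨h1.1.1.le, by linarith [h1.1.2]⟩
      ⟨h2.1.1.le, by linarith [h2.1.2]⟩ (h1.2.trans h2.2.symm)

theorem IsCoinsurance.increments (hI : IsCoinsurance v M θ a d I)
    (hanti : StrictAntiOn v (Icc (a - M) a)) (hθ : 0 ≤ θ) (hd : 0 ≤ d) :
    ∀ x ∈ Icc 0 M, ∀ y ∈ Icc 0 M, x ≤ y → 0 ≤ I y - I x ∧ I y - I x ≤ y - x := by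
  intro x hx y hy hxy
  rcases le_or_gt y d with hyd | hyd
  · rw [hI.1 x ⟨hx.1, hxy.trans hyd⟩, hI.1 y ⟨hy.1, hyd⟩]
    constructor <;> linarith
  obtain ⟨hIy, hey⟩ := hI.2 y ⟨hyd, hy.2⟩
  rcases le_or_gt x d with hxd | hxd
  · rw [hI.1 x ⟨hx.1, hxd⟩]
    constructor <;> linarith [hIy.1, hIy.2]
  obtain ⟨hIx, hex⟩ := hI.2 x ⟨hxd, hx.2⟩
  have hmx : a - x + I x ∈ Icc (a - M) a := ⟨by linarith [hIx.1, hx.2], by linarith [hIx.2]⟩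
  have hmy : a - y + I y ∈ Icc (a - M) a := ⟨by linarith [hIy.1, hy.2], by linarith [hIy.2]⟩
  have hmono : I x ≤ I y := by
    by_contra! hlt
    have h1 := mul_le_mul_of_nonneg_left hlt.le hθ
    have h2 := (hanti.le_iff_ge hmy hmx).1 (by linarith)
    linarith
  have h1 := mul_le_mul_of_nonneg_left hmono hθ
  have h2 := (hanti.le_iff_ge hmx hmy).1 (by linarith)
  constructor <;> linarith

theorem exists_isCoinsurance (hv : Continuous v) (hanti : StrictAntiOn v (Icc (a - M) a))
    (hθ : 0 ≤ θ) (hd : 0 ≤ d) (hdM : d < M) :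
    ∃ I, IsContract M I ∧ IsCoinsurance v M θ a d I := by
  have hex : ∀ x, ∃ y, (x ≤ d → y = 0) ∧
      (x ∈ Ioc d M → y ∈ Ioc 0 (x - d) ∧ v (a - x + y) - θ * y = v (a - d)) := by
    intro x
    by_cases hx : x ∈ Ioc d M
    · have hcont : ContinuousOn (fun y => v (a - x + y) - θ * y) (Icc 0 (x - d)) := by
        fun_prop
      have h0 : v (a - d) < v (a - x) :=
        hanti ⟨by linarith [hx.2], by linarith [hx.1]⟩ ⟨by linarith, by linarith⟩
          (by linarith [hx.1])
      have hmem : v (a - d) ∈ Icc (v (a - x + (x - d)) - θ * (x - d)) (v (a - x + 0) - θ * 0) := by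
        constructor
        · have e : a - x + (x - d) = a - d := by ring
          have := mul_nonneg hθ (by linarith [hx.1] : 0 ≤ x - d)
          rw [e]; linarith
        · simpa using h0.le
      obtain ⟨y, hy, hye⟩ := intermediate_value_Icc' (by linarith [hx.1]) hcont hmem
      refine ⟨y, fun h => absurd hx.1 (not_lt.2 h), fun _ => ⟨⟨hy.1.lt_of_ne ?_, hy.2⟩, hye⟩⟩
      rintro rfl
      simp only [add_zero, mul_zero, sub_zero] at hye
      exact h0.ne' hye
    · exact ⟨0, fun _ => rfl, fun h => absurd h hx⟩
  choose I hI0 hI1 using hex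
  have hI : IsCoinsurance v M θ a d I := ⟨fun x hx => hI0 x hx.2, hI1⟩
  have hproj : ∀ x ∈ Icc 0 M, max 0 (min x M) = x := fun x hx => by
    rw [min_eq_left hx.2, max_eq_right hx.1]
  have hmem : ∀ x, max 0 (min x M) ∈ Icc 0 M := fun x =>
    ⟨le_max_left _ _, max_le (hd.trans hdM.le) (min_le_right _ _)⟩
  -- outside `[0, M]` the solution is extended by constants, which makes it monotone
  have hmono : Monotone fun x => I (max 0 (min x M)) := fun x y hxy => by
    have := (hI.increments hanti hθ hd _ (hmem x) _ (hmem y) (by gcongr)).1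
    linarith
  refine ⟨fun x => I (max 0 (min x M)), ⟨hmono.measurable, fun x hx => ?_⟩, fun x hx => ?_,
    fun x hx => ?_⟩
  · simp only [hproj x hx]
    rcases le_or_gt x d with hxd | hxd
    · rw [hI.1 x ⟨hx.1, hxd⟩]
      exact ⟨le_rfl, hx.1⟩
    · have := (hI.2 x ⟨hxd, hx.2⟩).1
      exact ⟨this.1.le, by linarith [this.2]⟩
  · simp only [hproj x ⟨hx.1, hx.2.trans hdM.le⟩]
    exact hI.1 x hx
  · simp only [hproj x ⟨hd.trans hx.1.le, hx.2⟩]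
    exact hI.2 x hx

theorem isCoinsurance_stopLoss : IsCoinsurance v M 0 a d (stopLoss d) := by
  refine ⟨fun x hx => max_eq_right (by linarith [hx.2]), fun x hx => ?_⟩
  have e : stopLoss d x = x - d := max_eq_left (by linarith [hx.1])
  rw [e]
  exact ⟨⟨by linarith [hx.1], le_rfl⟩, by ring_nf⟩

theorem IsCoinsurance.lt_sub (hI : IsCoinsurance v M θ a d I) (hθ : 0 < θ) {x : ℝ}
    (hx : x ∈ Ioc d M) : I x < x - d := by
  obtain ⟨h1, h2⟩ := hI.2 x hx
  refine h1.2.lt_of_ne fun h => ?_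
  rw [h] at h2 h1
  have e : a - x + (x - d) = a - d := by ring
  rw [e] at h2
  have := mul_pos hθ h1.1
  linarith

end Coinsurance

theorem measurable_stopLoss (d : ℝ) : Measurable (stopLoss d) :=
  (measurable_id.sub_const d).max measurable_const

theorem isContract_stopLoss {M d : ℝ} (hd : 0 ≤ d) : IsContract M (stopLoss d) :=
  ⟨measurable_stopLoss d, fun _ hx => ⟨le_max_right _ _, max_le (by linarith) hx.1⟩⟩

theorem lipschitzWith_stopLoss (d : ℝ) : LipschitzWith 1 (stopLoss d) := by
  refine LipschitzWith.max_const (LipschitzWith.of_dist_le_mul fun x y => ?_) 0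
  simp

theorem variance_stopLoss_le {μ : Measure ℝ} [IsProbabilityMeasure μ]
    (hμ : MemLp (fun x => x) 2 μ) {d e : ℝ} (hde : d ≤ e) :
    variance (stopLoss e) μ ≤ variance (stopLoss d) μ := by
  have hm : MemLp (stopLoss d) 2 μ := (hμ.sub (memLp_const d)).sup (memLp_const 0)
  have heq : stopLoss e = fun x => stopLoss (e - d) (stopLoss d x) := by
    ext x
    simp only [stopLoss]
    grind
  rw [heq]
  exact variance_comp_le_of_contraction hm (lipschitzWith_stopLoss _)

namespace IsInsuranceModel

variable {μ : Measure ℝ} [IsProbabilityMeasure μ] {M w₀ ρ θ d : ℝ} {u v I : ℝ → ℝ}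

theorem strictAntiOn_sub (h : IsInsuranceModel μ M w₀ ρ u v) (hI : IsContract M I) :
    StrictAntiOn v (Icc (w₀ - (1 + ρ) * (∫ x, I x ∂μ) - M) (w₀ - (1 + ρ) * ∫ x, I x ∂μ)) := by
  refine h.marginal_strictAntiOn.mono fun z hz => ?_
  have := h.sub_mem hI (z := w₀ - (1 + ρ) * (∫ x, I x ∂μ) - z)
    ⟨by linarith [hz.2], by linarith [hz.1]⟩
  simpa using this

theorem integrable_marginal (h : IsInsuranceModel μ M w₀ ρ u v) {W : ℝ → ℝ} (hW : Measurable W) :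
    Integrable (fun x => v (W x)) μ := integrable_of_memLp_top (h.memLp_top_marginal hW)

theorem integrable_marginal_min (h : IsInsuranceModel μ M w₀ ρ u v) (a d : ℝ) :
    Integrable (fun x => v (a - min x d)) μ :=
  h.integrable_marginal (measurable_const.sub (measurable_id.min measurable_const))

theorem wealth_eq (I : ℝ → ℝ) (x : ℝ) :
    wealth μ w₀ ρ I x = w₀ - (1 + ρ) * (∫ y, I y ∂μ) - x + I x := by
  rw [wealth]; ring

/-- The marginal utility of the final wealth under a coinsurance contract. -/
theorem marginal_wealth_ae_eq (h : IsInsuranceModel μ M w₀ ρ u v)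
    (hco : IsCoinsurance v M θ (w₀ - (1 + ρ) * ∫ x, I x ∂μ) d I) : ∀ᵐ x ∂μ,
      v (wealth μ w₀ ρ I x) = v (w₀ - (1 + ρ) * (∫ y, I y ∂μ) - min x d) + θ * I x := by
  filter_upwards [h.ae_mem] with x hx
  rw [wealth_eq]
  rcases le_or_gt x d with hxd | hxd
  · rw [hco.1 x ⟨hx.1, hxd⟩, min_eq_left hxd]
    simp
  · rw [min_eq_right hxd.le, ← (hco.2 x ⟨hxd, hx.2⟩).2]
    ring

theorem integral_marginal_wealth (h : IsInsuranceModel μ M w₀ ρ u v) (hI : IsContract M I)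
    (hco : IsCoinsurance v M θ (w₀ - (1 + ρ) * ∫ x, I x ∂μ) d I) :
    ∫ x, v (wealth μ w₀ ρ I x) ∂μ =
      (∫ x, v (w₀ - (1 + ρ) * (∫ y, I y ∂μ) - min x d) ∂μ) + θ * ∫ x, I x ∂μ := by
  rw [integral_congr_ae (h.marginal_wealth_ae_eq hco),
    integral_add (h.integrable_marginal_min _ _) ((h.integrable_contract hI).const_mul θ),
    integral_const_mul]

/-- The equation that ties the multiplier to the deductible of a coinsurance contract. -/
def IsBalanced (μ : Measure ℝ) (w₀ ρ : ℝ) (v : ℝ → ℝ) (θ d : ℝ) (I : ℝ → ℝ) : Prop :=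
  θ * (ρ * ∫ x, I x ∂μ) = v (w₀ - (1 + ρ) * (∫ x, I x ∂μ) - d) -
    (1 + ρ) * ∫ x, v (w₀ - (1 + ρ) * (∫ y, I y ∂μ) - min x d) ∂μ

theorem isStationary_of_isCoinsurance (h : IsInsuranceModel μ M w₀ ρ u v) (hI : IsContract M I)
    (hd : 0 ≤ d) (hdM : d ≤ M) (hco : IsCoinsurance v M θ (w₀ - (1 + ρ) * ∫ x, I x ∂μ) d I)
    (hbal : IsBalanced μ w₀ ρ v θ d I) : IsStationary μ w₀ ρ v θ I := by
  filter_upwards [h.marginal_wealth_ae_eq hco, h.ae_mem] with x hx hxm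
  have hb := hbal
  rw [IsBalanced] at hb
  rw [gradient, hx, h.integral_marginal_wealth hI hco]
  have hle : v (w₀ - (1 + ρ) * (∫ y, I y ∂μ) - min x d) ≤
      v (w₀ - (1 + ρ) * (∫ y, I y ∂μ) - d) :=
    (h.strictAntiOn_sub hI).antitoneOn ⟨by linarith, by linarith⟩
      ⟨by linarith [min_le_right x d], by linarith [le_min hxm.1 hd]⟩
      (by linarith [min_le_right x d])
  refine ⟨by linarith, fun hne => ?_⟩
  have hxd : d < x := by
    by_contra! hxd
    exact hne (hco.1 x ⟨hxm.1, hxd⟩)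
  rw [min_eq_right hxd.le]
  linarith

theorem mean_pos (h : IsInsuranceModel μ M w₀ ρ u v) (hI : IsContract M I) {a : ℝ}
    (hd : 0 ≤ d) (hdM : d < M) (hco : IsCoinsurance v M θ a d I) : 0 < ∫ x, I x ∂μ := by
  refine (h.mean_nonneg hI).lt_of_ne fun h0 => ?_
  have hnn : 0 ≤ᵐ[μ] I := by filter_upwards [h.ae_mem] with x hx using (hI.2 x hx).1
  have hz := (integral_eq_zero_iff_of_nonneg_ae hnn (h.integrable_contract hI)).1 h0.symm
  obtain ⟨x, hx, hx0⟩ := h.exists_mem_Ioo_of_ae hd hdM le_rfl hz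
  exact (hco.2 x ⟨hx.1, hx.2.le⟩).1.1.ne' hx0

theorem loading_eq_zero_of_isBalanced (h : IsInsuranceModel μ M w₀ ρ u v) (hI : IsContract M I)
    (hθ : 0 ≤ θ) (hbal : IsBalanced μ w₀ ρ v θ 0 I) : ρ = 0 := by
  have h1 : ∫ x, v (w₀ - (1 + ρ) * (∫ y, I y ∂μ) - min x 0) ∂μ =
      v (w₀ - (1 + ρ) * (∫ y, I y ∂μ) - 0) := by
    have : (fun x => v (w₀ - (1 + ρ) * (∫ y, I y ∂μ) - min x 0)) =ᵐ[μ]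
        fun _ => v (w₀ - (1 + ρ) * (∫ y, I y ∂μ) - 0) := by
      filter_upwards [h.ae_mem] with x hx
      rw [min_eq_right hx.1]
    rw [integral_congr_ae this]; simp
  rw [IsBalanced, h1] at hbal
  have h2 := h.marginal_pos (w₀ - (1 + ρ) * (∫ y, I y ∂μ) - 0)
  have h3 := mul_nonneg hθ (mul_nonneg h.loading_nonneg (h.mean_nonneg hI))
  have h4 := h.loading_nonneg
  by_contra hne
  have h5 := mul_pos (h4.lt_of_ne (Ne.symm hne)) h2
  linarith

theorem integral_marginal_min_lt (h : IsInsuranceModel μ M w₀ ρ u v) (hI : IsContract M I)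
    (hd : 0 < d) (hdM : d ≤ M) :
    ∫ x, v (w₀ - (1 + ρ) * (∫ y, I y ∂μ) - min x d) ∂μ <
      v (w₀ - (1 + ρ) * (∫ y, I y ∂μ) - d) := by
  set a := w₀ - (1 + ρ) * ∫ y, I y ∂μ
  have hanti : StrictAntiOn v (Icc (a - M) a) := h.strictAntiOn_sub hI
  have hle : (fun x => v (a - min x d)) ≤ᵐ[μ] fun _ => v (a - d) := by
    filter_upwards [h.ae_mem] with x hx
    exact hanti.antitoneOn ⟨by linarith, by linarith⟩
      ⟨by linarith [min_le_right x d], by linarith [le_min hx.1 hd.le]⟩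
      (by linarith [min_le_right x d])
  have hint := h.integrable_marginal_min a d
  have h1 := integral_mono_ae hint (integrable_const _) hle
  have e : ∫ _, v (a - d) ∂μ = v (a - d) := by simp
  rw [e] at h1
  refine h1.lt_of_ne fun heq => ?_
  have h2 := (integral_eq_iff_of_ae_le hint (integrable_const _) hle).1 (heq.trans e.symm)
  obtain ⟨x, hx, hxe⟩ := h.exists_mem_Ioo_of_ae le_rfl hd hdM h2
  simp only [min_eq_left hx.2.le] at hxe
  exact (hanti ⟨by linarith, by linarith⟩ ⟨by linarith [hx.2], by linarith [hx.1]⟩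
    (by linarith [hx.2] : a - d < a - x)).ne hxe

theorem deductible_eq_zero_of_isBalanced (h : IsInsuranceModel μ M w₀ ρ u v)
    (hI : IsContract M I) (hd : 0 ≤ d) (hdM : d ≤ M) (hρ : ρ = 0)
    (hbal : IsBalanced μ w₀ ρ v θ d I) : d = 0 := by
  by_contra hne
  have h1 := h.integral_marginal_min_lt hI (hd.lt_of_ne (Ne.symm hne)) hdM
  rw [IsBalanced] at hbal
  subst hρ
  simp only [add_zero, one_mul, zero_mul, mul_zero] at hbal h1
  linarith

end IsInsuranceModel

namespace IsInsuranceModel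

variable {μ : Measure ℝ} [IsProbabilityMeasure μ] {M w₀ ρ θ d ν κ : ℝ} {u v I : ℝ → ℝ}

/-! ### The shape of an optimal contract -/

/-- The signs of the Lagrangian gradient `v(W) - θ I - κ` are compatible with the constraint
`0 ≤ I(x) ≤ x`. -/
def HasLagrangianSigns (μ : Measure ℝ) (w₀ ρ : ℝ) (v : ℝ → ℝ) (θ κ : ℝ) (I : ℝ → ℝ) : Prop :=
  ∀ᵐ x ∂μ, (κ < v (wealth μ w₀ ρ I x) - θ * I x → I x = x) ∧
    (v (wealth μ w₀ ρ I x) - θ * I x < κ → I x = 0)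

/-- Full insurance of small losses would force the Lagrangian gradient to have a positive mean,
which the loading rules out. -/
theorem marginal_le_of_hasLagrangianSigns (h : IsInsuranceModel μ M w₀ ρ u v)
    (hI : IsContract M I) (hθ : 0 ≤ θ)
    (hκ : κ = (1 + ρ) * (∫ x, v (wealth μ w₀ ρ I x) ∂μ) - θ * ∫ x, I x ∂μ)
    (hs : HasLagrangianSigns μ w₀ ρ v θ κ I) : v (w₀ - (1 + ρ) * ∫ x, I x ∂μ) ≤ κ := by
  by_contra! hlt
  set a := w₀ - (1 + ρ) * ∫ x, I x ∂μ with ha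
  have hanti : StrictAntiOn v (Icc (a - M) a) := h.strictAntiOn_sub hI
  have hva : ∀ x ∈ Icc 0 M, v a ≤ v (wealth μ w₀ ρ I x) := fun x hx => by
    have := hI.2 x hx
    rw [wealth_eq]
    exact hanti.antitoneOn ⟨by linarith [hx.2], by linarith⟩ ⟨by linarith [h.sup_pos], le_rfl⟩
      (by linarith)
  have hvi := h.integrable_marginal (measurable_wealth (μ := μ) (w₀ := w₀) (ρ := ρ) hI)
  have hi := (h.integrable_contract hI).const_mul θ
  have hnn : 0 ≤ᵐ[μ] fun x => v (wealth μ w₀ ρ I x) - θ * I x - κ := by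
    filter_upwards [hs, h.ae_mem] with x hx hxm
    by_contra! hneg
    simp only [Pi.zero_apply] at hneg
    have h0 := hx.2 (by linarith)
    have := hva x hxm
    rw [h0] at hneg
    linarith
  have hvs : Integrable (fun x => v (wealth μ w₀ ρ I x) - θ * I x) μ := hvi.sub hi
  have hint : Integrable (fun x => v (wealth μ w₀ ρ I x) - θ * I x - κ) μ :=
    hvs.sub (integrable_const _)
  have hval : ∫ x, (v (wealth μ w₀ ρ I x) - θ * I x - κ) ∂μ =
      -(ρ * ∫ x, v (wealth μ w₀ ρ I x) ∂μ) := by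
    rw [integral_sub hvs (integrable_const _), integral_sub hvi hi, integral_const_mul, hκ]
    simp
    ring
  have hvnn : 0 ≤ ∫ x, v (wealth μ w₀ ρ I x) ∂μ := integral_nonneg fun x => (h.marginal_pos _).le
  have hz := (integral_eq_zero_iff_of_nonneg_ae hnn hint).1 (le_antisymm
    (by rw [hval]; linarith [mul_nonneg h.loading_nonneg hvnn]) (integral_nonneg_of_ae hnn))
  -- the gradient is positive at losses below `(v(a) - κ) / (θ + 1)`
  have hε : 0 < min ((v a - κ) / (θ + 1)) M := lt_min (div_pos (by linarith) (by linarith)) h.sup_pos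
  obtain ⟨x, hx, hxz⟩ := h.exists_mem_Ioo_of_ae le_rfl hε (min_le_right _ _) hz
  have hxm : x ∈ Icc 0 M := ⟨hx.1.le, hx.2.le.trans (min_le_right _ _)⟩
  have h1 := hva x hxm
  have h2 := (lt_div_iff₀ (by linarith : 0 < θ + 1)).1 (hx.2.trans_le (min_le_left _ _))
  have h3 := mul_le_mul_of_nonneg_left (hI.2 x hxm).2 hθ
  simp only [Pi.zero_apply] at hxz
  nlinarith [hx.1]

theorem ae_eq_zero_of_hasLagrangianSigns (h : IsInsuranceModel μ M w₀ ρ u v)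
    (hI : IsContract M I) (hθ : 0 ≤ θ) (hs : HasLagrangianSigns μ w₀ ρ v θ κ I)
    (hκM : v (w₀ - (1 + ρ) * (∫ x, I x ∂μ) - M) ≤ κ) : ∀ᵐ x ∂μ, I x = 0 := by
  filter_upwards [hs, h.ae_mem] with x hx hxm
  by_contra hne
  have hIx := hI.2 x hxm
  have hpos := hIx.1.lt_of_ne (Ne.symm hne)
  refine hne (hx.2 ?_)
  have h1 := h.strictAntiOn_sub hI
    (a := w₀ - (1 + ρ) * (∫ x, I x ∂μ) - M) (b := w₀ - (1 + ρ) * (∫ x, I x ∂μ) - x + I x)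
    ⟨le_rfl, by linarith [h.sup_pos]⟩ ⟨by linarith [hxm.2], by linarith⟩ (by linarith [hxm.2])
  rw [wealth_eq]
  linarith [mul_nonneg hθ hIx.1]

theorem ae_eq_isCoinsurance_of_hasLagrangianSigns (h : IsInsuranceModel μ M w₀ ρ u v)
    (hI : IsContract M I) (hθ : 0 ≤ θ) (hd : 0 ≤ d) (hdM : d < M)
    (hs : HasLagrangianSigns μ w₀ ρ v θ (v (w₀ - (1 + ρ) * (∫ x, I x ∂μ) - d)) I) {J : ℝ → ℝ}
    (hJ : IsCoinsurance v M θ (w₀ - (1 + ρ) * ∫ x, I x ∂μ) d J) : ∀ᵐ x ∂μ, I x = J x := by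
  set a := w₀ - (1 + ρ) * ∫ x, I x ∂μ with ha
  have hanti : StrictAntiOn v (Icc (a - M) a) := h.strictAntiOn_sub hI
  filter_upwards [hs, h.ae_mem] with x hx hxm
  rw [wealth_eq, ← ha] at hx
  have hIx := hI.2 x hxm
  have hmono := strictAntiOn_marginal_sub hanti hθ hxm.2
  rcases le_or_gt x d with hxd | hxd
  · rw [hJ.1 x ⟨hxm.1, hxd⟩]
    by_contra hne
    have hpos := hIx.1.lt_of_ne (Ne.symm hne)
    refine hne (hx.2 ?_)
    have h1 : v (a - x + I x) < v (a - d) := hanti ⟨by linarith, by linarith⟩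
      ⟨by linarith, by linarith⟩ (by linarith)
    linarith [mul_nonneg hθ hIx.1]
  · obtain ⟨hJx, hJe⟩ := hJ.2 x ⟨hxd, hxm.2⟩
    have hJm : J x ∈ Icc 0 x := ⟨hJx.1.le, by linarith [hJx.2]⟩
    rcases lt_trichotomy (I x) (J x) with hlt | heq | hgt
    · have h1 := hmono hIx hJm hlt
      simp only [hJe] at h1
      have := hx.1 h1
      linarith [hJm.2]
    · exact heq
    · have h1 := hmono hJm hIx hgt
      simp only [hJe] at h1
      have := hx.2 h1
      linarith [hJm.1]

/-- No stop-loss contract with deductible above `d₀` satisfies the first-order condition of the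
problem without variance constraint. -/
def ExceedsArrow (μ : Measure ℝ) (M w₀ ρ : ℝ) (v : ℝ → ℝ) (d₀ : ℝ) : Prop :=
  ∀ d ∈ Ioo d₀ M, (1 + ρ) * ∫ x, v (w₀ - (1 + ρ) * (∫ y, stopLoss d y ∂μ) - min x d) ∂μ <
    v (w₀ - (1 + ρ) * (∫ y, stopLoss d y ∂μ) - d)

theorem lt_sup_of_variance_stopLoss_pos (h : IsInsuranceModel μ M w₀ ρ u v)
    (hd : 0 < variance (stopLoss d) μ) : d < M := by
  by_contra! hle
  have : stopLoss d =ᵐ[μ] 0 := by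
    filter_upwards [h.ae_mem] with x hx
    exact max_eq_right (by linarith [hx.2])
  rw [variance_congr this, variance_zero] at hd
  exact hd.false

/-- Above the Arrow deductible, some stop-loss contract improves on no insurance. -/
theorem not_isStationary_zero (h : IsInsuranceModel μ M w₀ ρ u v) {d₀ : ℝ} (hd₀ : 0 ≤ d₀)
    (hdM : d₀ < M) (harrow : ExceedsArrow μ M w₀ ρ v d₀) (hI : IsContract M I)
    (hI0 : ∀ᵐ x ∂μ, I x = 0) (hs : IsStationary μ w₀ ρ v 0 I) : False := by
  obtain ⟨d, hd⟩ := exists_between hdM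
  have hd0 : 0 ≤ d := hd₀.trans hd.1.le
  have hJ : IsContract M (stopLoss d) := isContract_stopLoss hd0
  have hco : IsCoinsurance v M 0 (w₀ - (1 + ρ) * ∫ x, stopLoss d x ∂μ) d (stopLoss d) :=
    isCoinsurance_stopLoss
  have h1 := h.expectedUtility_le_add_gradient hI hJ
  have h2 := h.expectedUtility_le_add_gradient hJ hI
  have h3 : ∫ x, gradient μ w₀ ρ v I x * (stopLoss d x - I x) ∂μ ≤ 0 := by
    refine integral_nonpos_of_ae ?_
    filter_upwards [hs, hI0, h.ae_mem] with x hx hx0 hxm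
    rw [zero_mul, sub_zero] at hx
    rw [hx0, sub_zero]
    exact mul_nonpos_of_nonpos_of_nonneg hx.1 (hJ.2 x hxm).1
  have h4 : ∫ x, gradient μ w₀ ρ v (stopLoss d) x * (I x - stopLoss d x) ∂μ =
      -((v (w₀ - (1 + ρ) * (∫ y, stopLoss d y ∂μ) - d) -
        (1 + ρ) * ∫ x, v (w₀ - (1 + ρ) * (∫ y, stopLoss d y ∂μ) - min x d) ∂μ) *
          ∫ x, stopLoss d x ∂μ) := by
    rw [← neg_mul, ← integral_const_mul]
    refine integral_congr_ae ?_
    filter_upwards [h.marginal_wealth_ae_eq hco, hI0, h.ae_mem] with x hx hx0 hxm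
    rw [gradient, h.integral_marginal_wealth hJ hco, hx, hx0]
    rcases le_or_gt x d with hxd | hxd
    · rw [hco.1 x ⟨hxm.1, hxd⟩]; ring
    · rw [min_eq_right hxd.le]; ring
  have h5 := mul_pos (sub_pos.2 (harrow d hd)) (h.mean_pos hJ hd0 hd.2 hco)
  linarith

theorem IsMaximizer.exists_isCoinsurance (h : IsInsuranceModel μ M w₀ ρ u v) (hν : 0 < ν)
    (hI : IsMaximizer μ M w₀ ρ u ν I) {d₀ : ℝ} (hd₀ : 0 ≤ d₀)
    (hbind : ν < variance (stopLoss d₀) μ) (harrow : ExceedsArrow μ M w₀ ρ v d₀) :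
    ∃ (θ d : ℝ) (J : ℝ → ℝ), 0 < θ ∧ 0 ≤ d ∧ d < M ∧ IsContract M J ∧
      IsCoinsurance v M θ (w₀ - (1 + ρ) * ∫ x, J x ∂μ) d J ∧ IsBalanced μ w₀ ρ v θ d J ∧
      variance J μ = ν := by
  obtain ⟨θ, hθ, hslack, hsign⟩ := hI.exists_lagrangian_sign h hν
  set a := w₀ - (1 + ρ) * ∫ x, I x ∂μ with ha
  set κ := (1 + ρ) * (∫ x, v (wealth μ w₀ ρ I x) ∂μ) - θ * ∫ x, I x ∂μ with hκ
  have hL : ∀ x, gradient μ w₀ ρ v I x - θ * (I x - ∫ y, I y ∂μ) =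
      v (wealth μ w₀ ρ I x) - θ * I x - κ := fun x => by rw [gradient, hκ]; ring
  have hs : HasLagrangianSigns μ w₀ ρ v θ κ I := by
    filter_upwards [hsign] with x hx
    rw [hL] at hx
    exact ⟨fun hlt => hx.1 (by linarith), fun hlt => hx.2 (by linarith)⟩
  have hanti : StrictAntiOn v (Icc (a - M) a) := h.strictAntiOn_sub hI.1
  have hκa : v a ≤ κ := h.marginal_le_of_hasLagrangianSigns hI.1 hθ hκ hs
  have hd₀M : d₀ < M := h.lt_sup_of_variance_stopLoss_pos (hν.trans hbind)
  rcases le_or_gt (v (a - M)) κ with hκM | hκM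
  · -- no insurance is excluded by the Arrow deductible if the multiplier vanishes, and by its zero
    -- variance otherwise
    exfalso
    have hI0 := h.ae_eq_zero_of_hasLagrangianSigns hI.1 hθ hs hκM
    rcases hslack with rfl | hvar
    · refine h.not_isStationary_zero hd₀ hd₀M harrow hI.1 hI0 ?_
      filter_upwards [hsign, hI0] with x hx hx0
      refine ⟨?_, fun hne => absurd hx0 hne⟩
      by_contra! hpos
      -- full insurance and no insurance agree at `x = 0` only
      obtain rfl : x = 0 := (hx.1 hpos).symm.trans hx0
      rw [hL, wealth_eq, hx0, ← ha] at hpos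
      simp only [sub_zero, add_zero, mul_zero] at hpos
      linarith
    · have : I =ᵐ[μ] 0 := hI0
      rw [variance_congr this, variance_zero] at hvar
      exact hν.ne hvar
  obtain ⟨d, hd, hdκ⟩ : ∃ d ∈ Icc 0 M, v (a - d) = κ := by
    have hc : ContinuousOn (fun d => v (a - d)) (Icc 0 M) :=
      (h.marginal_continuous.comp (by fun_prop)).continuousOn
    exact intermediate_value_Icc h.sup_pos.le hc ⟨by simpa using hκa, hκM.le⟩
  have hdM : d < M := hd.2.lt_of_ne fun he => by rw [he] at hdκ; exact hκM.ne' hdκ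
  obtain ⟨J, hJ, hco⟩ :=
    VarianceContract.exists_isCoinsurance h.marginal_continuous hanti hθ hd.1 hdM
  have hIJ : I =ᵐ[μ] J := h.ae_eq_isCoinsurance_of_hasLagrangianSigns hI.1 hθ hd.1 hdM
    (by rw [← ha, hdκ]; exact hs) hco
  have hmean : ∫ x, I x ∂μ = ∫ x, J x ∂μ := integral_congr_ae hIJ
  rw [ha, hmean] at hco
  have hbal : IsBalanced μ w₀ ρ v θ d J := by
    have h1 := h.integral_marginal_wealth hJ hco
    have h2 : ∫ x, v (wealth μ w₀ ρ I x) ∂μ = ∫ x, v (wealth μ w₀ ρ J x) ∂μ :=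
      integral_comp_wealth_congr hIJ
    rw [h2, h1, ← hdκ, ha, hmean] at hκ
    rw [IsBalanced]
    linarith
  have hθpos : 0 < θ := by
    refine hθ.lt_of_ne fun h0 => ?_
    subst h0
    have hJs : ∀ x ∈ Icc 0 M, J x = stopLoss d x := by
      rw [← hmean, ← ha] at hco
      exact hco.eqOn isCoinsurance_stopLoss hanti le_rfl hd.1
    have hJe : J =ᵐ[μ] stopLoss d := by filter_upwards [h.ae_mem] with x hx using hJs x hx
    have hd₀d : d₀ < d := by
      by_contra! hle
      have h1 := variance_stopLoss_le (memLp_two_of_top h.memLp_top_id) hle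
      have h2 := hI.2.1
      rw [variance_congr (hIJ.trans hJe)] at h2
      linarith
    have h1 := harrow d ⟨hd₀d, hdM⟩
    rw [← integral_congr_ae hJe] at h1
    rw [IsBalanced] at hbal
    linarith
  refine ⟨θ, d, J, hθpos, hd.1, hdM, hJ, hco, hbal, ?_⟩
  rw [← variance_congr hIJ]
  exact hslack.resolve_left hθpos.ne'

end IsInsuranceModel

/-! ### Bounds on the mean, the deductible, and uniqueness -/

/-- If `g` lies below `f` where `f < c` and above `f` where `f > c`, and the mean moves
towards `c`, if at all, then `f` has the smaller variance, unless `f` and `g` differ by a constant. -/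
theorem ae_sub_eq_of_crossing {α : Type*} [MeasurableSpace α] {μ : Measure α}
    [IsProbabilityMeasure μ] {f g : α → ℝ} (hf : MemLp f 2 μ) (hg : MemLp g 2 μ) {c : ℝ}
    (hcross : ∀ᵐ x ∂μ, 0 ≤ (f x - c) * (g x - f x))
    (hmean : 0 ≤ (c - ∫ x, f x ∂μ) * (∫ x, g x ∂μ - ∫ x, f x ∂μ))
    (hvar : variance g μ ≤ variance f μ) :
    ∀ᵐ x ∂μ, g x - f x = ∫ x, g x ∂μ - ∫ x, f x ∂μ := by
  have hfi := hf.integrable one_le_two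
  have hgi := hg.integrable one_le_two
  have hk : MemLp (fun x => g x - f x) 2 μ := hg.sub hf
  have hki := hk.integrable one_le_two
  have hE : ∫ x, g x - f x ∂μ = ∫ x, g x ∂μ - ∫ x, f x ∂μ := integral_sub hgi hfi
  have h1 := variance_eq_add_cross hf hk
  have e : (fun x => f x + (g x - f x)) = g := by ext; ring
  rw [e] at h1
  have hci : Integrable (fun x => (f x - c) * (g x - f x)) μ :=
    (hf.sub (memLp_const c)).integrable_mul hk
  have h2 : ∫ x, (f x - ∫ y, f y ∂μ) * (g x - f x) ∂μ =
      ∫ x, (f x - c) * (g x - f x) ∂μ + (c - ∫ x, f x ∂μ) * ∫ x, (g x - f x) ∂μ := by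
    rw [← integral_const_mul, ← integral_add hci (hki.const_mul _)]
    congr 1; ext x; ring
  have h3 : 0 ≤ ∫ x, (f x - c) * (g x - f x) ∂μ := integral_nonneg_of_ae hcross
  have h4 : variance (fun x => g x - f x) μ = 0 :=
    le_antisymm (by rw [← hE] at hmean; linarith) (variance_nonneg _ _)
  filter_upwards [ae_eq_integral_of_variance_eq_zero hk h4] with x hx
  rw [← hE, hx]

namespace IsInsuranceModel

variable {μ : Measure ℝ} [IsProbabilityMeasure μ] {M w₀ ρ θ d ν : ℝ} {u v I : ℝ → ℝ}

theorem memLp_two_contract (h : IsInsuranceModel μ M w₀ ρ u v) (hI : IsContract M I) :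
    MemLp I 2 μ := memLp_two_of_top (h.memLp_top_contract hI)

theorem isContract_min {K : ℝ} (hK : 0 ≤ K) : IsContract M (fun x => min x K) :=
  ⟨measurable_id.min measurable_const, fun _ hx => ⟨le_min hx.1 hK, min_le_left _ _⟩⟩

theorem continuous_integral_of_continuous (h : IsInsuranceModel μ M w₀ ρ u v) {F : ℝ → ℝ → ℝ}
    (hF : Continuous F.uncurry) : Continuous fun d => ∫ x, F d x ∂μ := by
  have := continuous_parametric_integral_of_continuous (μ := μ) hF (isCompact_Icc (a := 0) (b := M))
  rwa [Measure.restrict_eq_self_of_ae_mem h.ae_mem] at this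

theorem continuous_variance_of_continuous (h : IsInsuranceModel μ M w₀ ρ u v) {F : ℝ → ℝ → ℝ}
    (hF : Continuous F.uncurry) (hF2 : ∀ d, MemLp (F d) 2 μ) :
    Continuous fun d => variance (F d) μ := by
  simp_rw [fun d => variance_eq_sub (hF2 d)]
  exact (h.continuous_integral_of_continuous (F := fun d x => F d x ^ 2)
      (continuous_pow 2 |>.comp hF)).sub
    ((h.continuous_integral_of_continuous hF).pow 2)

theorem continuous_uncurry_stopLoss : Continuous (Function.uncurry stopLoss) :=
  (continuous_snd.sub continuous_fst).max continuous_const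

theorem memLp_two_stopLoss (h : IsInsuranceModel μ M w₀ ρ u v) (d : ℝ) :
    MemLp (stopLoss d) 2 μ :=
  ((h.memLp_two_contract isContract_id).sub (memLp_const d)).sup (memLp_const 0)

theorem memLp_two_min (h : IsInsuranceModel μ M w₀ ρ u v) (K : ℝ) :
    MemLp (fun x => min x K) 2 μ :=
  (h.memLp_two_contract isContract_id).inf (memLp_const K)

/-- Among the contracts of a given variance, capped full insurance has the largest mean. -/
theorem mean_lt_integral_min (h : IsInsuranceModel μ M w₀ ρ u v) (hI : IsContract M I)
    (hlt : ∀ x ∈ Ioo 0 M, I x < x) {K : ℝ} (hK : 0 ≤ K) (hpos : 0 < variance I μ)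
    (hvar : variance I μ ≤ variance (fun x => min x K) μ) :
    ∫ x, I x ∂μ < ∫ x, min x K ∂μ := by
  by_contra! hle
  have hKpos : 0 < K := by
    refine hK.lt_of_ne fun h0 => ?_
    have : (fun x => min x K) =ᵐ[μ] 0 := by
      filter_upwards [h.ae_mem] with x hx
      rw [← h0]; exact min_eq_right hx.1
    rw [variance_congr this, variance_zero] at hvar
    linarith
  have hKc : IsContract M (fun x => min x K) := isContract_min hK
  have hEK : ∫ x, min x K ∂μ ≤ K := by
    have := integral_mono (h.integrable_contract hKc) (integrable_const K)
      (fun x => min_le_right x K)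
    simpa using this
  have hae := ae_sub_eq_of_crossing (h.memLp_two_contract hKc) (h.memLp_two_contract hI) (c := K)
    (by
      filter_upwards [h.ae_mem] with x hx
      rcases le_or_gt x K with hxK | hxK
      · rw [min_eq_left hxK]
        exact mul_nonneg_of_nonpos_of_nonpos (by linarith) (by linarith [(hI.2 x hx).2])
      · rw [min_eq_right hxK.le, sub_self, zero_mul])
    (mul_nonneg (by linarith) (by linarith)) hvar
  obtain ⟨x, hx, hxe⟩ := h.exists_mem_Ioo_of_ae le_rfl (lt_min hKpos h.sup_pos)
    (min_le_right _ _) hae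
  have h1 := hlt x ⟨hx.1, hx.2.trans_le (min_le_right _ _)⟩
  rw [min_eq_left (hx.2.le.trans (min_le_left _ _))] at hxe
  linarith

/-- A contract with increments between `0` and those of the loss crosses a stop-loss contract at
most once, and from above. -/
theorem exists_crossing (hM : 0 ≤ M) (hI : IsContract M I)
    (hinc : ∀ x ∈ Icc 0 M, ∀ y ∈ Icc 0 M, x ≤ y → 0 ≤ I y - I x ∧ I y - I x ≤ y - x)
    (hd : 0 ≤ d) : ∃ c, ∀ x ∈ Icc 0 M, 0 ≤ (I x - c) * (stopLoss d x - I x) := by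
  have hMm : M ∈ Icc 0 M := ⟨hM, le_rfl⟩
  have hle : ∀ x, x ≤ d → stopLoss d x = 0 := fun x hx => max_eq_right (by linarith)
  have hge : ∀ x, d ≤ x → stopLoss d x = x - d := fun x hx => max_eq_left (by linarith)
  rcases le_or_gt (stopLoss d M) (I M) with hIM | hIM
  · refine ⟨I M, fun x hx => ?_⟩
    have h1 := hinc x hx M hMm hx.2
    refine mul_nonneg_of_nonpos_of_nonpos (by linarith) ?_
    rcases le_or_gt x d with hxd | hxd
    · rw [hle x hxd]; linarith [(hI.2 x hx).1]
    · rw [hge M (hxd.le.trans hx.2)] at hIM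
      rw [hge x hxd.le]; linarith
  · have hdM : d < M := by
      by_contra! hMd
      rw [hle M hMd] at hIM
      exact absurd hIM (not_lt.2 (hI.2 M hMm).1)
    have hcont : ContinuousOn I (Icc 0 M) := by
      refine (LipschitzOnWith.of_dist_le_mul (K := 1) fun x hx y hy => ?_).continuousOn
      rw [Real.dist_eq, Real.dist_eq, NNReal.coe_one, one_mul]
      rcases le_total x y with hxy | hxy
      · have := hinc x hx y hy hxy
        rw [abs_sub_comm, abs_of_nonneg this.1, abs_sub_comm, abs_of_nonneg (by linarith)]
        exact this.2
      · have := hinc y hy x hx hxy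
        rw [abs_of_nonneg this.1, abs_of_nonneg (by linarith)]
        exact this.2
    have hc2 : ContinuousOn (fun x => stopLoss d x - I x) (Icc d M) :=
      (lipschitzWith_stopLoss d).continuous.continuousOn.sub
        (hcont.mono (Icc_subset_Icc_left hd))
    obtain ⟨z, hz, hze⟩ := intermediate_value_Icc hdM.le hc2
      (show (0 : ℝ) ∈ Icc _ _ from ⟨by
        rw [hle d le_rfl]; linarith [(hI.2 d ⟨hd, hdM.le⟩).1], by linarith⟩)
    have hzm : z ∈ Icc 0 M := ⟨hd.trans hz.1, hz.2⟩
    simp only [hge z hz.1] at hze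
    refine ⟨I z, fun x hx => ?_⟩
    rcases le_total x z with hxz | hxz
    · have h1 := hinc x hx z hzm hxz
      refine mul_nonneg_of_nonpos_of_nonpos (by linarith) ?_
      rcases le_or_gt x d with hxd | hxd
      · rw [hle x hxd]; linarith [(hI.2 x hx).1]
      · rw [hge x hxd.le]; linarith
    · have h1 := hinc z hzm x hx hxz
      rw [hge x (hz.1.trans hxz)]
      exact mul_nonneg (by linarith) (by linarith)

/-- Among the coinsurance contracts of a given variance, the stop-loss contracts have the smallest
mean. -/
theorem integral_stopLoss_lt_mean (h : IsInsuranceModel μ M w₀ ρ u v) (hI : IsContract M I)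
    (hθ : 0 < θ) (hd : 0 ≤ d) (hdM : d < M)
    (hco : IsCoinsurance v M θ (w₀ - (1 + ρ) * ∫ x, I x ∂μ) d I) {e : ℝ} (he : 0 ≤ e)
    (hvar : variance (stopLoss e) μ ≤ variance I μ) : ∫ x, stopLoss e x ∂μ < ∫ x, I x ∂μ := by
  by_contra! hle
  have hcont : Continuous fun t => ∫ x, stopLoss t x ∂μ :=
    h.continuous_integral_of_continuous continuous_uncurry_stopLoss
  have hend : ∫ x, stopLoss (max e M) x ∂μ = 0 := by
    refine integral_eq_zero_of_ae ?_
    filter_upwards [h.ae_mem] with x hx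
    exact max_eq_right (by linarith [hx.2, le_max_right e M])
  -- comparison with the stop-loss contract of the same mean
  obtain ⟨t, ht, hte⟩ := intermediate_value_Icc' (le_max_left e M) hcont.continuousOn
    (show ∫ x, I x ∂μ ∈ Icc _ _ from ⟨by rw [hend]; exact h.mean_nonneg hI, hle⟩)
  have ht0 : 0 ≤ t := he.trans ht.1
  obtain ⟨c, hc⟩ := exists_crossing h.sup_pos.le hI
    (hco.increments (h.strictAntiOn_sub hI) hθ.le hd) ht0
  simp only at hte
  have hae := ae_sub_eq_of_crossing (h.memLp_two_contract hI) (h.memLp_two_stopLoss t) (c := c)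
    (by filter_upwards [h.ae_mem] with x hx using hc x hx) (by rw [hte, sub_self, mul_zero])
    ((variance_stopLoss_le (h.memLp_two_contract isContract_id) ht.1).trans hvar)
  rw [hte, sub_self] at hae
  rcases lt_or_ge d t with hdt | hdt
  · obtain ⟨x, hx, hxe⟩ := h.exists_mem_Ioo_of_ae hd (lt_min hdt hdM) (min_le_right _ _) hae
    have h1 := (hco.2 x ⟨hx.1, hx.2.le.trans (min_le_right _ _)⟩).1.1
    have h2 : stopLoss t x = 0 := max_eq_right (by linarith [hx.2, min_le_left t M])
    linarith
  · obtain ⟨x, hx, hxe⟩ := h.exists_mem_Ioo_of_ae hd hdM le_rfl hae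
    have h1 := hco.lt_sub hθ ⟨hx.1, hx.2.le⟩
    have h2 : stopLoss t x = x - t := max_eq_left (by linarith [hx.1])
    linarith

/-- A coinsurance contract with a positive multiplier has its deductible above the quantile of order
`ρ / (1 + ρ)`. -/
theorem exists_quantile_lt (h : IsInsuranceModel μ M w₀ ρ u v) (hI : IsContract M I)
    (hθ : 0 < θ) (hρ : 0 < ρ) (hd : 0 < d) (hdM : d < M)
    (hco : IsCoinsurance v M θ (w₀ - (1 + ρ) * ∫ x, I x ∂μ) d I)
    (hbal : IsBalanced μ w₀ ρ v θ d I) :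
    ∃ z ∈ Ico 0 d, ρ / (1 + ρ) ≤ μ.real (Iic z) := by
  have hC := mul_pos hθ (mul_pos hρ (h.mean_pos hI hd.le hdM hco))
  rw [IsBalanced] at hbal
  rw [hbal] at hC
  have hanti := h.strictAntiOn_sub hI
  set a := w₀ - (1 + ρ) * ∫ x, I x ∂μ with ha
  set E := ∫ x, v (a - min x d) ∂μ with hE
  have hc : Tendsto (fun z => v (a - z)) (𝓝[<] d) (𝓝 (v (a - d))) :=
    ((h.marginal_continuous.comp (by fun_prop : Continuous fun z => a - z)).tendsto d).mono_left
      nhdsWithin_le_nhds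
  obtain ⟨z, hz, hzm⟩ := ((hc.eventually_const_lt (sub_pos.1 hC)).and
    (Ioo_mem_nhdsLT hd)).exists
  refine ⟨z, ⟨hzm.1.le, hzm.2⟩, ?_⟩
  have h1 : v (a - z) * μ.real (Ioi z) ≤ E := by
    rw [mul_comm, ← smul_eq_mul, ← integral_indicator_const (v (a - z)) measurableSet_Ioi]
    refine integral_mono_ae ((integrable_const _).indicator measurableSet_Ioi)
      (h.integrable_marginal_min a d) ?_
    filter_upwards [h.ae_mem] with x hx
    by_cases hxz : x ∈ Ioi z
    · rw [indicator_of_mem hxz]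
      have hzx : z < x := hxz
      have hmin : min x d ≤ M := (min_le_left _ _).trans hx.2
      exact hanti.antitoneOn ⟨by linarith, by linarith [le_min hx.1 hd.le]⟩
        ⟨by linarith [hzm.2], by linarith [hzm.1]⟩ (by linarith [le_min hzx.le hzm.2.le])
    · rw [indicator_of_notMem hxz]
      exact (h.marginal_pos _).le
  have h2 : μ.real (Ioi z) = 1 - μ.real (Iic z) := by
    rw [← compl_Iic, probReal_compl_eq_one_sub measurableSet_Iic]
  have h3 : (1 + ρ) * μ.real (Ioi z) < 1 := by
    have h4 := mul_le_mul_of_nonneg_left h1 (by linarith : 0 ≤ 1 + ρ)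
    have h5 := h.marginal_pos (a - z)
    by_contra! hge
    have := mul_le_mul_of_nonneg_left hge h5.le
    linarith
  rw [h2] at h3
  rw [div_le_iff₀ (by linarith)]
  linarith

theorem eq_of_isCoinsurance (h : IsInsuranceModel μ M w₀ ρ u v) {θ' d' : ℝ} {J : ℝ → ℝ}
    (hI : IsContract M I) (hθ : 0 ≤ θ) (hd : 0 ≤ d) (hdM : d < M)
    (hco : IsCoinsurance v M θ (w₀ - (1 + ρ) * ∫ x, I x ∂μ) d I)
    (hbal : IsBalanced μ w₀ ρ v θ d I)
    (hJ : IsContract M J) (hθ' : 0 ≤ θ') (hd' : 0 ≤ d') (hdM' : d' < M)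
    (hco' : IsCoinsurance v M θ' (w₀ - (1 + ρ) * ∫ x, J x ∂μ) d' J)
    (hbal' : IsBalanced μ w₀ ρ v θ' d' J) (hvar : variance J μ = variance I μ) :
    d' = d ∧ θ' = θ ∧ ∀ x ∈ Icc 0 M, J x = I x := by
  have hsI := h.isStationary_of_isCoinsurance hI hd hdM.le hco hbal
  have hsJ := h.isStationary_of_isCoinsurance hJ hd' hdM'.le hco' hbal'
  have hae : J =ᵐ[μ] I := h.ae_eq_of_isStationary hθ hI hsI hJ hvar.le
    (h.expectedUtility_le_of_isStationary hθ' hJ hsJ hI hvar.ge)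
  have hm : ∫ x, J x ∂μ = ∫ x, I x ∂μ := integral_congr_ae hae
  rw [hm] at hco'
  have hdle : ∀ {θ₁ θ₂ d₁ d₂ a : ℝ} {I₁ I₂ : ℝ → ℝ}, IsCoinsurance v M θ₁ a d₁ I₁ →
      IsCoinsurance v M θ₂ a d₂ I₂ → 0 ≤ d₁ → d₁ < M → I₁ =ᵐ[μ] I₂ → d₂ ≤ d₁ := by
    intro θ₁ θ₂ d₁ d₂ a I₁ I₂ h₁ h₂ hd₁ hd₁M hae
    by_contra! hlt
    obtain ⟨x, hx, hxe⟩ := h.exists_mem_Ioo_of_ae hd₁ (lt_min hlt hd₁M) (min_le_right _ _) hae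
    have h3 := (h₁.2 x ⟨hx.1, hx.2.le.trans (min_le_right _ _)⟩).1.1
    have h4 := h₂.1 x ⟨hd₁.trans hx.1.le, hx.2.le.trans (min_le_left _ _)⟩
    linarith
  obtain rfl : d' = d := le_antisymm (hdle hco hco' hd hdM hae.symm) (hdle hco' hco hd' hdM' hae)
  obtain ⟨x, hx, hxe⟩ := h.exists_mem_Ioo_of_ae hd hdM le_rfl hae
  obtain rfl : θ' = θ := by
    obtain ⟨h1, h2⟩ := hco.2 x ⟨hx.1, hx.2.le⟩
    obtain ⟨h3, h4⟩ := hco'.2 x ⟨hx.1, hx.2.le⟩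
    rw [hxe] at h4
    exact mul_right_cancel₀ h1.1.ne' (by linarith)
  exact ⟨rfl, rfl, hco'.eqOn hco (h.strictAntiOn_sub hI) hθ hd⟩

end IsInsuranceModel

/-! ### From the loss to its law -/

namespace IsUtilityOn

variable {U : ℝ → ℝ} {S : Set ℝ}

theorem continuousOn_deriv (hU : IsUtilityOn U S) : ContinuousOn (deriv U) S :=
  fun w hw => (hU.differentiable_deriv w hw).continuousAt.continuousWithinAt

theorem strictAntiOn_deriv (hU : IsUtilityOn U S) : StrictAntiOn (deriv U) S :=
  strictAntiOn_of_deriv_neg hU.ordConnected.convex hU.continuousOn_deriv fun w hw =>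
    hU.deriv_deriv_neg w (interior_subset hw)

theorem lt_tangent (hU : IsUtilityOn U S) {a b : ℝ} (ha : a ∈ S) (hb : b ∈ S) (hab : a ≠ b) :
    U b < U a + deriv U a * (b - a) := by
  have hmvt : ∀ {x y}, x ∈ S → y ∈ S → x < y →
      ∃ c ∈ Ioo x y, c ∈ S ∧ U y - U x = deriv U c * (y - x) := by
    intro x y hx hy hxy
    have hsub : Icc x y ⊆ S := hU.ordConnected.out hx hy
    obtain ⟨c, hc, hce⟩ := exists_deriv_eq_slope U hxy
      (fun w hw => (hU.differentiable w (hsub hw)).continuousAt.continuousWithinAt)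
      (fun w hw => (hU.differentiable w (hsub (Ioo_subset_Icc_self hw))).differentiableWithinAt)
    exact ⟨c, hc, hsub (Ioo_subset_Icc_self hc), by
      rw [hce, div_mul_cancel₀ _ (sub_pos.2 hxy).ne']⟩
  rcases lt_or_gt_of_ne hab with hlt | hgt
  · obtain ⟨c, hc, hcS, hce⟩ := hmvt ha hb hlt
    have := mul_lt_mul_of_pos_right (hU.strictAntiOn_deriv ha hcS hc.1) (sub_pos.2 hlt)
    linarith
  · obtain ⟨c, hc, hcS, hce⟩ := hmvt hb ha hgt
    have := mul_lt_mul_of_pos_right (hU.strictAntiOn_deriv hcS ha hc.2) (sub_pos.2 hgt)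
    linarith

end IsUtilityOn

/-- The nearest point to `w` in `[a, b]`. -/
def clamp (a b w : ℝ) : ℝ := max a (min w b)

theorem clamp_mem {a b : ℝ} (hab : a ≤ b) (w : ℝ) : clamp a b w ∈ Icc a b :=
  ⟨le_max_left _ _, max_le hab (min_le_right _ _)⟩

theorem clamp_of_mem {a b w : ℝ} (hw : w ∈ Icc a b) : clamp a b w = w := by
  rw [clamp, min_eq_left hw.2, max_eq_right hw.1]

theorem lipschitzWith_clamp (a b : ℝ) : LipschitzWith 1 (clamp a b) :=
  (LipschitzWith.id.min_const b).const_max a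

theorem continuous_comp_clamp {f : ℝ → ℝ} {a b : ℝ} (hab : a ≤ b) (hf : ContinuousOn f (Icc a b)) :
    Continuous fun w => f (clamp a b w) :=
  hf.comp_continuous (lipschitzWith_clamp a b).continuous (clamp_mem hab)

theorem exists_abs_comp_clamp_le {f : ℝ → ℝ} {a b : ℝ} (hab : a ≤ b)
    (hf : ContinuousOn f (Icc a b)) : ∃ C, ∀ w, |f (clamp a b w)| ≤ C := by
  obtain ⟨C, hC⟩ := isCompact_Icc.exists_bound_of_continuousOn hf
  exact ⟨C, fun w => hC _ (clamp_mem hab w)⟩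

variable {Ω : Type*} [MeasurableSpace Ω] {P : Measure Ω} [IsProbabilityMeasure P] {X : Ω → ℝ}

/-- The lowest wealth level that indemnity functions can lead to. -/
noncomputable def minWealth (P : Measure Ω) (X : Ω → ℝ) (w₀ ρ : ℝ) : ℝ := w₀ - lossSup P X - premium P ρ X

/-- The law of the loss, together with the utility and the marginal utility clamped to the interval
of attainable wealth levels. -/
def IsLossModel (P : Measure Ω) (X : Ω → ℝ) (U : ℝ → ℝ) (w₀ ρ : ℝ) : Prop :=
  IsInsuranceModel (P.map X) (lossSup P X) w₀ ρ
    (fun w => U (clamp (minWealth P X w₀ ρ) w₀ w))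
    (fun w => deriv U (clamp (minWealth P X w₀ ρ) w₀ w))

theorem ae_mem_Icc_lossSup (hX0 : ∀ᵐ ω ∂P, 0 ≤ X ω) (hXb : ∃ C : ℝ, ∀ᵐ ω ∂P, X ω ≤ C) :
    ∀ᵐ ω ∂P, X ω ∈ Icc 0 (lossSup P X) := by
  obtain ⟨C, hC⟩ := hXb
  have h1 : ∀ᵐ ω ∂P, X ω ≤ essSup X P := ae_le_essSup ⟨C, hC⟩
  filter_upwards [hX0, h1] with ω h0 h1 using ⟨h0, h1⟩

theorem lossSup_pos (hX0 : ∀ᵐ ω ∂P, 0 ≤ X ω) (hXb : ∃ C : ℝ, ∀ᵐ ω ∂P, X ω ≤ C) {d : ℝ}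
    (hpos : 0 < variance (fun ω => stopLoss d (X ω)) P) : 0 < lossSup P X := by
  by_contra! hle
  have : (fun ω => stopLoss d (X ω)) =ᵐ[P] fun _ => stopLoss d 0 := by
    filter_upwards [ae_mem_Icc_lossSup hX0 hXb] with ω hω
    rw [le_antisymm (hω.2.trans hle) hω.1]
  rw [variance_congr this, ← variance_sub_const aestronglyMeasurable_const (stopLoss d 0)] at hpos
  simp only [sub_self] at hpos
  have h0 : variance (fun _ : Ω => (0 : ℝ)) P = 0 := variance_zero P
  rw [h0] at hpos
  exact hpos.false

theorem integral_map_loss (hX : Measurable X) {f : ℝ → ℝ} (hf : Measurable f) :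
    ∫ x, f x ∂(P.map X) = ∫ ω, f (X ω) ∂P :=
  integral_map hX.aemeasurable hf.aestronglyMeasurable

theorem variance_map_loss (hX : Measurable X) {f : ℝ → ℝ} (hf : Measurable f) :
    variance f (P.map X) = variance (fun ω => f (X ω)) P :=
  variance_map hf.aemeasurable hX.aemeasurable

theorem isLossModel (hX : Measurable X) (hX0 : ∀ᵐ ω ∂P, 0 ≤ X ω)
    (hXb : ∃ C : ℝ, ∀ᵐ ω ∂P, X ω ≤ C)
    (hF : StrictMonoOn (lossCdf P X) (Ioo 0 (lossSup P X))) (hM : 0 < lossSup P X)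
    {w₀ ρ : ℝ} (hρ : 0 ≤ ρ) {U : ℝ → ℝ} {S : Set ℝ} (hU : IsUtilityOn U S)
    (hS : Icc (minWealth P X w₀ ρ) w₀ ⊆ S) : IsLossModel P X U w₀ ρ := by
  have hmem := ae_mem_Icc_lossSup hX0 hXb
  have hlo : minWealth P X w₀ ρ ≤ w₀ := by
    have : 0 ≤ premium P ρ X := mul_nonneg (by linarith) (integral_nonneg_of_ae hX0)
    rw [minWealth]; linarith
  have hcl := clamp_mem hlo
  have hUc : ContinuousOn U (Icc (minWealth P X w₀ ρ) w₀) := fun w hw =>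
    (hU.differentiable w (hS hw)).continuousAt.continuousWithinAt
  have hVc := hU.continuousOn_deriv.mono hS
  obtain ⟨C, hC⟩ := exists_abs_comp_clamp_le hlo hVc
  lift C to NNReal using (abs_nonneg _).trans (hC 0)
  have hint : ∫ x, x ∂(P.map X) = ∫ ω, X ω ∂P := integral_map_loss hX measurable_id
  have hD : Icc (w₀ - lossSup P X - (1 + ρ) * ∫ x, x ∂(P.map X)) w₀ =
      Icc (minWealth P X w₀ ρ) w₀ := by
    rw [hint]; rfl
  refine ⟨hM, (ae_map_iff hX.aemeasurable measurableSet_Icc).2 hmem, ?_, hρ,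
    ⟨C, LipschitzWith.of_le_add_mul _ fun x y => ?_⟩, exists_abs_comp_clamp_le hlo hUc,
    continuous_comp_clamp hlo hVc, ⟨C, hC⟩, fun w => hU.deriv_pos _ (hS (hcl w)), ?_, ?_⟩
  · intro a b ha hab hb h0
    obtain ⟨t, ht⟩ := exists_between hab
    obtain ⟨s, hs⟩ := exists_between ht.1
    have hlt := hF (a := s) (b := t) ⟨by linarith [hs.1], by linarith [hs.2, ht.2]⟩
      ⟨by linarith [ht.1], by linarith [ht.2]⟩ hs.2
    rw [Measure.map_apply hX measurableSet_Ioo] at h0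
    refine hlt.not_ge ?_
    have h1 : {ω | X ω ≤ t} ⊆ {ω | X ω ≤ s} ∪ X ⁻¹' Ioo a b := by
      intro ω hω
      by_cases hωs : X ω ≤ s
      · exact Or.inl hωs
      · exact Or.inr ⟨hs.1.trans (not_le.1 hωs), lt_of_le_of_lt hω ht.2⟩
    have h2 := (measureReal_mono h1).trans (measureReal_union_le (μ := P) _ _)
    have h3 : P.real (X ⁻¹' Ioo a b) = 0 := by rw [measureReal_def, h0, ENNReal.toReal_zero]
    rw [h3, add_zero] at h2
    exact h2
  · rcases eq_or_ne (clamp (minWealth P X w₀ ρ) w₀ y) (clamp (minWealth P X w₀ ρ) w₀ x) with he | he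
    · simp only [he]
      have := mul_nonneg C.2 (dist_nonneg (x := x) (y := y))
      simpa using this
    · have h1 := hU.lt_tangent (hS (hcl y)) (hS (hcl x)) he
      have h2 := (lipschitzWith_clamp (minWealth P X w₀ ρ) w₀).dist_le_mul x y
      rw [NNReal.coe_one, one_mul, Real.dist_eq] at h2
      have h3 : deriv U (clamp (minWealth P X w₀ ρ) w₀ y) *
          (clamp (minWealth P X w₀ ρ) w₀ x - clamp (minWealth P X w₀ ρ) w₀ y) ≤ C * dist x y := by
        refine (le_abs_self _).trans ?_
        rw [abs_mul]
        exact mul_le_mul (hC y) h2 (abs_nonneg _) C.2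
      exact h1.le.trans (add_le_add_right h3 _)
  · rw [hD]
    intro a ha b hb hab
    simp only [clamp_of_mem ha, clamp_of_mem hb]
    exact hU.strictAntiOn_deriv (hS ha) (hS hb) hab
  · rw [hD]
    intro a ha b hb hab
    simp only [clamp_of_mem ha, clamp_of_mem hb]
    exact hU.lt_tangent (hS ha) (hS hb) hab

namespace IsLossModel

variable {U I : ℝ → ℝ} {w₀ ρ ν : ℝ}

theorem ae_loss_mem (h : IsLossModel P X U w₀ ρ) (hX : Measurable X) :
    ∀ᵐ ω ∂P, X ω ∈ Icc 0 (lossSup P X) := ae_of_ae_map hX.aemeasurable h.ae_mem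

theorem attainable_eq (hX : Measurable X) :
    Icc (w₀ - lossSup P X - (1 + ρ) * ∫ x, x ∂(P.map X)) w₀ = Icc (minWealth P X w₀ ρ) w₀ := by
  have : ∫ x, x ∂(P.map X) = ∫ ω, X ω ∂P := integral_map_loss hX measurable_id
  rw [this]; rfl

theorem finalWealth_eq (hX : Measurable X) (hI : Measurable I) (ω : Ω) :
    finalWealth P X w₀ ρ I ω = wealth (P.map X) w₀ ρ I (X ω) := by
  rw [finalWealth, wealth, premium, integral_map_loss hX hI]

theorem clamp_sub (h : IsLossModel P X U w₀ ρ) (hX : Measurable X)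
    (hI : IsContract (lossSup P X) I) {z : ℝ} (hz : z ∈ Icc 0 (lossSup P X)) :
    clamp (minWealth P X w₀ ρ) w₀ (w₀ - (1 + ρ) * (∫ x, I x ∂(P.map X)) - z) =
      w₀ - (1 + ρ) * (∫ x, I x ∂(P.map X)) - z := by
  have : IsProbabilityMeasure (P.map X) := Measure.isProbabilityMeasure_map hX.aemeasurable
  have h1 := IsInsuranceModel.sub_mem h hI hz
  rw [attainable_eq hX] at h1
  exact clamp_of_mem h1

theorem expectedUtility_eq (h : IsLossModel P X U w₀ ρ) (hX : Measurable X)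
    (hI : IsContract (lossSup P X) I) : expectedUtility P X U w₀ ρ I =
      ∫ x, U (clamp (minWealth P X w₀ ρ) w₀ (wealth (P.map X) w₀ ρ I x)) ∂(P.map X) := by
  have : IsProbabilityMeasure (P.map X) := Measure.isProbabilityMeasure_map hX.aemeasurable
  obtain ⟨C, hC⟩ := h.lipschitz
  rw [integral_map_loss hX (f := fun x =>
    U (clamp (minWealth P X w₀ ρ) w₀ (wealth (P.map X) w₀ ρ I x)))
    (hC.continuous.measurable.comp (IsInsuranceModel.measurable_wealth hI))]
  refine integral_congr_ae ?_
  filter_upwards [h.ae_loss_mem hX] with ω hω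
  have h1 := IsInsuranceModel.wealth_mem h hI hω
  rw [attainable_eq hX] at h1
  rw [clamp_of_mem h1, finalWealth_eq hX hI.1]

theorem variance_exposure_eq (hX : Measurable X) (hI : Measurable I) :
    variance (exposure P X ρ I) P = variance I (P.map X) := by
  rw [variance_map_loss hX hI]
  exact variance_sub_const (hI.comp hX).aestronglyMeasurable _

theorem isOptimal_iff (h : IsLossModel P X U w₀ ρ) (hX : Measurable X) :
    IsOptimal P X U w₀ ρ ν I ↔ IsInsuranceModel.IsMaximizer (P.map X) (lossSup P X) w₀ ρ
      (fun w => U (clamp (minWealth P X w₀ ρ) w₀ w)) ν I := by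
  constructor
  · rintro ⟨⟨hI, hv⟩, hmax⟩
    refine ⟨hI, by rwa [← variance_exposure_eq (ρ := ρ) hX hI.1], fun J hJ hJv => ?_⟩
    rw [← h.expectedUtility_eq hX hJ, ← h.expectedUtility_eq hX hI]
    exact hmax J ⟨hJ, by rwa [variance_exposure_eq hX hJ.1]⟩
  · rintro ⟨hI, hv, hmax⟩
    refine ⟨⟨hI, by rwa [variance_exposure_eq hX hI.1]⟩, fun J hJ => ?_⟩
    rw [h.expectedUtility_eq hX hJ.1, h.expectedUtility_eq hX hI]
    exact hmax J hJ.1 (by rw [← variance_exposure_eq (ρ := ρ) hX hJ.1.1]; exact hJ.2)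

theorem valueAtRisk_nonneg (ρ : ℝ) : 0 ≤ valueAtRisk P X ρ :=
  Real.sInf_nonneg fun _ hx => hx.1.1

theorem arrowDeductible_nonneg : 0 ≤ arrowDeductible P X U w₀ ρ :=
  (valueAtRisk_nonneg ρ).trans (le_max_right _ _)

theorem integral_deriv_min (h : IsLossModel P X U w₀ ρ) (hX : Measurable X)
    (hI : IsContract (lossSup P X) I) {d : ℝ} (hd : d ∈ Icc 0 (lossSup P X)) :
    ∫ x, deriv U (clamp (minWealth P X w₀ ρ) w₀
        (w₀ - (1 + ρ) * (∫ y, I y ∂(P.map X)) - min x d)) ∂(P.map X) =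
      ∫ ω, deriv U (w₀ - (1 + ρ) * (∫ y, I y ∂(P.map X)) - min (X ω) d) ∂P := by
  rw [integral_map_loss hX (f := fun x => deriv U (clamp (minWealth P X w₀ ρ) w₀
      (w₀ - (1 + ρ) * (∫ y, I y ∂(P.map X)) - min x d)))
    (h.marginal_continuous.measurable.comp
      (measurable_const.sub (measurable_id.min measurable_const)))]
  refine integral_congr_ae ?_
  filter_upwards [h.ae_loss_mem hX] with ω hω
  rw [h.clamp_sub hX hI ⟨le_min hω.1 hd.1, (min_le_left _ _).trans hω.2⟩]

theorem exceedsArrow (h : IsLossModel P X U w₀ ρ) (hX : Measurable X) :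
    IsInsuranceModel.ExceedsArrow (P.map X) (lossSup P X) w₀ ρ
      (fun w => deriv U (clamp (minWealth P X w₀ ρ) w₀ w)) (arrowDeductible P X U w₀ ρ) := by
  intro d hd
  have hd0 : 0 ≤ d := arrowDeductible_nonneg.trans hd.1.le
  have hdm : d ∈ Icc 0 (lossSup P X) := ⟨hd0, hd.2.le⟩
  have hρ := IsInsuranceModel.loading_nonneg h
  have hcon : IsContract (lossSup P X) (stopLoss d) := isContract_stopLoss hd0
  have hphi : phi P X U w₀ ρ d < 1 / (1 + ρ) := by
    by_contra! hge
    have hbdd : BddAbove {d | valueAtRisk P X ρ ≤ d ∧ d < lossSup P X ∧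
        1 / (1 + ρ) ≤ phi P X U w₀ ρ d} := ⟨lossSup P X, fun x hx => hx.2.1.le⟩
    have h1 := le_csSup hbdd ⟨(le_max_right _ _).trans hd.1.le, hd.2, hge⟩
    exact absurd (h1.trans (le_max_left _ (valueAtRisk P X ρ))) (not_le.2 hd.1)
  have hpos := IsInsuranceModel.marginal_pos h
    (w₀ - (1 + ρ) * (∫ y, stopLoss d y ∂(P.map X)) - d)
  have hprem : premium P ρ (fun ω => stopLoss d (X ω)) =
      (1 + ρ) * ∫ y, stopLoss d y ∂(P.map X) := by
    rw [premium, integral_map_loss hX (measurable_stopLoss d)]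
  have hW : ∀ ω, finalWealth P X w₀ ρ (stopLoss d) ω =
      w₀ - (1 + ρ) * (∫ y, stopLoss d y ∂(P.map X)) - min (X ω) d := by
    intro ω
    rw [finalWealth, hprem, stopLoss]
    rcases le_total (X ω) d with hle | hle
    · rw [min_eq_left hle, max_eq_right (by linarith)]; ring
    · rw [min_eq_right hle, max_eq_left (by linarith)]; ring
  have hnum := h.integral_deriv_min hX hcon hdm
  simp only [h.clamp_sub hX hcon hdm] at hpos ⊢
  rw [hnum]
  simp_rw [phi, hW, hprem] at hphi
  rw [sub_right_comm] at hphi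
  rw [div_lt_div_iff₀ hpos (by linarith)] at hphi
  linarith

end IsLossModel

/-! ### Solutions of the systems of the theorem -/

/-- The common form of the systems for `ρ = 0` (where `d = 0` and `θ = 2β`) and for `ρ > 0`: a
coinsurance contract of variance `ν` whose multiplier, deductible and mean are balanced. -/
structure IsSolution (P : Measure Ω) (X : Ω → ℝ) (U : ℝ → ℝ) (w₀ ρ ν θ d : ℝ) (I : ℝ → ℝ) :
    Prop where
  isContract : IsContract (lossSup P X) I
  multiplier_nonneg : 0 ≤ θ
  deductible_nonneg : 0 ≤ d
  deductible_lt : d < lossSup P X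
  isCoinsurance : IsCoinsurance (fun w => deriv U (clamp (minWealth P X w₀ ρ) w₀ w)) (lossSup P X)
    θ (w₀ - (1 + ρ) * ∫ x, I x ∂(P.map X)) d I
  isBalanced : IsInsuranceModel.IsBalanced (P.map X) w₀ ρ
    (fun w => deriv U (clamp (minWealth P X w₀ ρ) w₀ w)) θ d I
  variance_eq : variance I (P.map X) = ν

namespace IsSolution

variable {U I J : ℝ → ℝ} {w₀ ρ ν θ d : ℝ}

theorem isStationary (hs : IsSolution P X U w₀ ρ ν θ d I) (h : IsLossModel P X U w₀ ρ)
    (hX : Measurable X) : IsInsuranceModel.IsStationary (P.map X) w₀ ρ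
      (fun w => deriv U (clamp (minWealth P X w₀ ρ) w₀ w)) θ I := by
  have : IsProbabilityMeasure (P.map X) := Measure.isProbabilityMeasure_map hX.aemeasurable
  exact IsInsuranceModel.isStationary_of_isCoinsurance h hs.isContract hs.deductible_nonneg
    hs.deductible_lt.le hs.isCoinsurance hs.isBalanced

theorem isOptimal (hs : IsSolution P X U w₀ ρ ν θ d I) (h : IsLossModel P X U w₀ ρ)
    (hX : Measurable X) : IsOptimal P X U w₀ ρ ν I := by
  have : IsProbabilityMeasure (P.map X) := Measure.isProbabilityMeasure_map hX.aemeasurable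
  refine (h.isOptimal_iff hX).2 ⟨hs.isContract, hs.variance_eq.le, fun K hK hKv => ?_⟩
  exact IsInsuranceModel.expectedUtility_le_of_isStationary h hs.multiplier_nonneg hs.isContract
    (hs.isStationary h hX) hK (hKv.trans hs.variance_eq.ge)

theorem ae_eq (hs : IsSolution P X U w₀ ρ ν θ d I) (h : IsLossModel P X U w₀ ρ)
    (hX : Measurable X) (hJ : IsOptimal P X U w₀ ρ ν J) : ∀ᵐ ω ∂P, J (X ω) = I (X ω) := by
  have : IsProbabilityMeasure (P.map X) := Measure.isProbabilityMeasure_map hX.aemeasurable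
  have hJ' := (h.isOptimal_iff hX).1 hJ
  exact ae_of_ae_map hX.aemeasurable (IsInsuranceModel.ae_eq_of_isStationary h
    hs.multiplier_nonneg hs.isContract (hs.isStationary h hX) hJ'.1
    (hJ'.2.1.trans hs.variance_eq.ge) (hJ'.2.2 I hs.isContract hs.variance_eq.le))

theorem isIncentiveCompatible (hs : IsSolution P X U w₀ ρ ν θ d I) (h : IsLossModel P X U w₀ ρ)
    (hX : Measurable X) : IsIncentiveCompatible P X I := by
  have : IsProbabilityMeasure (P.map X) := Measure.isProbabilityMeasure_map hX.aemeasurable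
  exact ⟨hs.isCoinsurance.1 0 ⟨le_rfl, hs.deductible_nonneg⟩,
    hs.isCoinsurance.increments (IsInsuranceModel.strictAntiOn_sub h hs.isContract)
      hs.multiplier_nonneg hs.deductible_nonneg⟩

theorem unique {θ' d' : ℝ} (hs : IsSolution P X U w₀ ρ ν θ d I)
    (hs' : IsSolution P X U w₀ ρ ν θ' d' J) (h : IsLossModel P X U w₀ ρ) (hX : Measurable X) :
    d' = d ∧ θ' = θ ∧ ∀ x ∈ Icc 0 (lossSup P X), J x = I x := by
  have : IsProbabilityMeasure (P.map X) := Measure.isProbabilityMeasure_map hX.aemeasurable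
  exact IsInsuranceModel.eq_of_isCoinsurance h hs.isContract hs.multiplier_nonneg
    hs.deductible_nonneg hs.deductible_lt hs.isCoinsurance hs.isBalanced hs'.isContract
    hs'.multiplier_nonneg hs'.deductible_nonneg hs'.deductible_lt hs'.isCoinsurance hs'.isBalanced
    (hs'.variance_eq.trans hs.variance_eq.symm)

theorem deductible_eq_zero (hs : IsSolution P X U w₀ ρ ν θ d I) (h : IsLossModel P X U w₀ ρ)
    (hX : Measurable X) (hρ : ρ = 0) : d = 0 := by
  have : IsProbabilityMeasure (P.map X) := Measure.isProbabilityMeasure_map hX.aemeasurable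
  exact IsInsuranceModel.deductible_eq_zero_of_isBalanced h hs.isContract hs.deductible_nonneg
    hs.deductible_lt.le hρ hs.isBalanced

theorem deductible_pos (hs : IsSolution P X U w₀ ρ ν θ d I) (h : IsLossModel P X U w₀ ρ)
    (hX : Measurable X) (hρ : 0 < ρ) : 0 < d := by
  have : IsProbabilityMeasure (P.map X) := Measure.isProbabilityMeasure_map hX.aemeasurable
  refine hs.deductible_nonneg.lt_of_ne fun h0 => hρ.ne' ?_
  have hb := hs.isBalanced
  rw [← h0] at hb
  exact IsInsuranceModel.loading_eq_zero_of_isBalanced h hs.isContract hs.multiplier_nonneg hb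

theorem mean_pos (hs : IsSolution P X U w₀ ρ ν θ d I) (h : IsLossModel P X U w₀ ρ)
    (hX : Measurable X) : 0 < ∫ x, I x ∂(P.map X) := by
  have : IsProbabilityMeasure (P.map X) := Measure.isProbabilityMeasure_map hX.aemeasurable
  exact IsInsuranceModel.mean_pos h hs.isContract hs.deductible_nonneg hs.deductible_lt
    hs.isCoinsurance

theorem lt_self (hs : IsSolution P X U w₀ ρ ν θ d I) (hθ : 0 < θ) {x : ℝ}
    (hx : x ∈ Ioc 0 (lossSup P X)) : I x < x := by
  rcases le_or_gt x d with hxd | hxd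
  · rw [hs.isCoinsurance.1 x ⟨hx.1.le, hxd⟩]; exact hx.1
  · have := hs.isCoinsurance.lt_sub hθ ⟨hxd, hx.2⟩
    linarith [hs.deductible_nonneg]

theorem valueAtRisk_lt (hs : IsSolution P X U w₀ ρ ν θ d I) (h : IsLossModel P X U w₀ ρ)
    (hX : Measurable X) (hθ : 0 < θ) (hρ : 0 < ρ) : valueAtRisk P X ρ < d := by
  have : IsProbabilityMeasure (P.map X) := Measure.isProbabilityMeasure_map hX.aemeasurable
  obtain ⟨z, hz, hzq⟩ := IsInsuranceModel.exists_quantile_lt h hs.isContract hθ hρ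
    (hs.deductible_pos h hX hρ) hs.deductible_lt hs.isCoinsurance hs.isBalanced
  rw [map_measureReal_apply hX measurableSet_Iic] at hzq
  have hle : valueAtRisk P X ρ ≤ z :=
    csInf_le ⟨0, fun x hx => hx.1.1⟩ ⟨⟨hz.1, hz.2.le.trans hs.deductible_lt.le⟩, hzq⟩
  exact hle.trans_lt hz.2

theorem mean_mem (hs : IsSolution P X U w₀ ρ ν θ d I) (h : IsLossModel P X U w₀ ρ)
    (hX : Measurable X) (hθ : 0 < θ) (hν : 0 < ν)
    (hbind : ν < variance (stopLoss (arrowDeductible P X U w₀ ρ)) (P.map X)) :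
    ∫ x, I x ∂(P.map X) ∈ Ioo (meanL P X U w₀ ρ ν) (meanU P X ν) := by
  have : IsProbabilityMeasure (P.map X) := Measure.isProbabilityMeasure_map hX.aemeasurable
  have hd₀ : 0 ≤ arrowDeductible P X U w₀ ρ := IsLossModel.arrowDeductible_nonneg
  have hM := IsInsuranceModel.sup_pos h
  constructor
  · set T := {d | arrowDeductible P X U w₀ ρ ≤ d ∧ variance (fun ω => stopLoss d (X ω)) P ≤ ν}
      with hT
    have hcont : Continuous fun d => variance (stopLoss d) (P.map X) :=
      IsInsuranceModel.continuous_variance_of_continuous h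
        IsInsuranceModel.continuous_uncurry_stopLoss (IsInsuranceModel.memLp_two_stopLoss h)
    simp_rw [variance_map_loss hX (measurable_stopLoss _)] at hcont
    have hclosed : IsClosed T := isClosed_Ici.inter (isClosed_le hcont continuous_const)
    have hne : T.Nonempty := by
      refine ⟨max (arrowDeductible P X U w₀ ρ) (lossSup P X), le_max_left _ _, ?_⟩
      have h0 : (fun ω => stopLoss (max (arrowDeductible P X U w₀ ρ) (lossSup P X)) (X ω)) =ᵐ[P]
          0 := by
        filter_upwards [h.ae_loss_mem hX] with ω hω
        exact max_eq_right (by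
          linarith [hω.2, le_max_right (arrowDeductible P X U w₀ ρ) (lossSup P X)])
      rw [variance_congr h0, variance_zero]
      exact hν.le
    have hmem : deductibleL P X U w₀ ρ ν ∈ T :=
      hclosed.csInf_mem hne ⟨_, fun x hx => hx.1⟩
    have h1 := IsInsuranceModel.integral_stopLoss_lt_mean h hs.isContract hθ hs.deductible_nonneg
      hs.deductible_lt hs.isCoinsurance (hd₀.trans hmem.1)
      (by rw [hs.variance_eq, variance_map_loss hX (measurable_stopLoss _)]; exact hmem.2)
    rwa [integral_map_loss hX (measurable_stopLoss _)] at h1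
  · set T := {k | 0 ≤ k ∧ ν ≤ variance (fun ω => min (X ω) k) P} with hT
    have hmeas : ∀ k : ℝ, Measurable fun x : ℝ => min x k := fun k =>
      measurable_id.min measurable_const
    have hcont : Continuous fun k : ℝ => variance (fun x => min x k) (P.map X) :=
      IsInsuranceModel.continuous_variance_of_continuous h (F := fun k x => min x k)
        (continuous_snd.min continuous_fst) (IsInsuranceModel.memLp_two_min h)
    rw [funext fun k => variance_map_loss hX (hmeas k)] at hcont
    have hclosed : IsClosed T := isClosed_Ici.inter (isClosed_le continuous_const hcont)
    have hne : T.Nonempty := by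
      refine ⟨lossSup P X, hM.le, ?_⟩
      rw [← variance_map_loss hX (hmeas _)]
      have h0 : (fun x => min x (lossSup P X)) =ᵐ[P.map X] stopLoss 0 := by
        filter_upwards [IsInsuranceModel.ae_mem h] with x hx
        rw [min_eq_left hx.2, stopLoss, sub_zero, max_eq_left hx.1]
      rw [variance_congr h0]
      exact hbind.le.trans (variance_stopLoss_le
        (IsInsuranceModel.memLp_two_contract h IsInsuranceModel.isContract_id) hd₀)
    have hmem : capU P X ν ∈ T := hclosed.csInf_mem hne ⟨0, fun x hx => hx.1⟩
    have h1 := IsInsuranceModel.mean_lt_integral_min h hs.isContract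
      (fun x hx => hs.lt_self hθ ⟨hx.1, hx.2.le⟩) hmem.1 (by rw [hs.variance_eq]; exact hν)
      (by rw [hs.variance_eq, variance_map_loss hX (hmeas _)]; exact hmem.2)
    rwa [integral_map_loss hX (hmeas _)] at h1

theorem deductible_iff (hs : IsSolution P X U w₀ ρ ν θ d I) (h : IsLossModel P X U w₀ ρ)
    (hX : Measurable X) (hJ : IsOptimal P X U w₀ ρ ν J) :
    (∃ δ > 0, ∀ᵐ ω ∂P, X ω ≤ δ → J (X ω) = 0) ↔ 0 < ρ := by
  have : IsProbabilityMeasure (P.map X) := Measure.isProbabilityMeasure_map hX.aemeasurable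
  have hJI := hs.ae_eq h hX hJ
  constructor
  · rintro ⟨δ, hδ, hJ0⟩
    refine (IsInsuranceModel.loading_nonneg h).lt_of_ne fun hρ => ?_
    have hd := hs.deductible_eq_zero h hX hρ.symm
    have hI0 : ∀ᵐ ω ∂P, X ω ≤ δ → I (X ω) = 0 := by
      filter_upwards [hJI, hJ0] with ω h1 h2 h3
      rw [← h1, h2 h3]
    have hmeas : MeasurableSet {x | x ≤ δ → I x = 0} := by
      have : {x | x ≤ δ → I x = 0} = {x | δ < x} ∪ {x | I x = 0} := by
        ext x; simp only [mem_ofPred_eq, mem_union, ← not_le]; tauto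
      rw [this]
      exact (measurableSet_lt measurable_const measurable_id).union
        (hs.isContract.1 (measurableSet_singleton 0))
    obtain ⟨x, hx, hx0⟩ := IsInsuranceModel.exists_mem_Ioo_of_ae h le_rfl
      (lt_min hδ (IsInsuranceModel.sup_pos h)) (min_le_right _ _)
      ((ae_map_iff hX.aemeasurable hmeas).2 hI0)
    have h1 := (hs.isCoinsurance.2 x
      ⟨by rw [hd]; exact hx.1, hx.2.le.trans (min_le_right _ _)⟩).1.1
    exact h1.ne' (hx0 (hx.2.le.trans (min_le_left _ _)))
  · intro hρ
    refine ⟨d, hs.deductible_pos h hX hρ, ?_⟩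
    filter_upwards [hJI, h.ae_loss_mem hX] with ω h1 h2 h3
    rw [h1, hs.isCoinsurance.1 _ ⟨h2.1, h3⟩]

end IsSolution

namespace IsLossModel

variable {U I J : ℝ → ℝ} {w₀ ρ ν θ d m : ℝ}

theorem exists_isSolution (h : IsLossModel P X U w₀ ρ) (hX : Measurable X) (hν : 0 < ν)
    (hbind : ν < variance (stopLoss (arrowDeductible P X U w₀ ρ)) (P.map X)) :
    ∃ θ d I, 0 < θ ∧ IsSolution P X U w₀ ρ ν θ d I := by
  have : IsProbabilityMeasure (P.map X) := Measure.isProbabilityMeasure_map hX.aemeasurable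
  obtain ⟨I, hI⟩ := IsInsuranceModel.exists_optimal h hν.le
  obtain ⟨θ, d, J, hθ, hd, hdM, hJ, hco, hbal, hvar⟩ :=
    IsInsuranceModel.IsMaximizer.exists_isCoinsurance h hν hI arrowDeductible_nonneg hbind
      (h.exceedsArrow hX)
  exact ⟨θ, d, J, hθ, hJ, hθ.le, hd, hdM, hco, hbal, hvar⟩

theorem clamp_sub_add (h : IsLossModel P X U w₀ ρ) (hX : Measurable X)
    (hI : IsContract (lossSup P X) I) {x : ℝ} (hx : x ∈ Icc 0 (lossSup P X)) :
    clamp (minWealth P X w₀ ρ) w₀ (w₀ - (1 + ρ) * (∫ x, I x ∂(P.map X)) - x + I x) =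
      w₀ - (1 + ρ) * (∫ x, I x ∂(P.map X)) - x + I x := by
  have hIx := hI.2 x hx
  have := h.clamp_sub hX hI (z := x - I x) ⟨by linarith, by linarith [hx.2]⟩
  rwa [← sub_add] at this

theorem isCoinsurance_of_deriv (h : IsLossModel P X U w₀ ρ) (hX : Measurable X)
    (hI : IsContract (lossSup P X) I) (hθ : 0 ≤ θ) (hd : 0 ≤ d) (hdM : d < lossSup P X)
    (hzero : ∀ x ∈ Icc 0 d, I x = 0) (heq : ∀ x ∈ Ioc d (lossSup P X), I x ∈ Ioo 0 x ∧
      deriv U (w₀ - (1 + ρ) * (∫ x, I x ∂(P.map X)) - x + I x) - θ * I x =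
        deriv U (w₀ - (1 + ρ) * (∫ x, I x ∂(P.map X)) - d)) :
    IsCoinsurance (fun w => deriv U (clamp (minWealth P X w₀ ρ) w₀ w)) (lossSup P X)
      θ (w₀ - (1 + ρ) * ∫ x, I x ∂(P.map X)) d I := by
  have : IsProbabilityMeasure (P.map X) := Measure.isProbabilityMeasure_map hX.aemeasurable
  refine ⟨hzero, fun x hx => ?_⟩
  have hxm : x ∈ Icc 0 (lossSup P X) := ⟨hd.trans hx.1.le, hx.2⟩
  obtain ⟨h1, h2⟩ := heq x hx
  rw [← h.clamp_sub_add hX hI hxm, ← h.clamp_sub hX hI ⟨hd, hdM.le⟩] at h2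
  refine ⟨⟨h1.1, ?_⟩, h2⟩
  have hle := ((IsInsuranceModel.strictAntiOn_sub h hI).le_iff_ge
    (a := w₀ - (1 + ρ) * (∫ x, I x ∂(P.map X)) - d)
    (b := w₀ - (1 + ρ) * (∫ x, I x ∂(P.map X)) - x + I x)
    ⟨by linarith, by linarith⟩ ⟨by linarith [hx.2, h1.1], by linarith [h1.2]⟩).1
    (by linarith [mul_nonneg hθ h1.1.le])
  linarith

theorem isSolution_of_solvesCoinsurance (h : IsLossModel P X U w₀ 0) (hX : Measurable X) {β : ℝ}
    (hs : SolvesCoinsurance P X U w₀ ν m β I) : IsSolution P X U w₀ 0 ν (2 * β) 0 I := by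
  have : IsProbabilityMeasure (P.map X) := Measure.isProbabilityMeasure_map hX.aemeasurable
  obtain ⟨hI, -, hβ, heq, hm, hvar⟩ := hs
  have hM := IsInsuranceModel.sup_pos h
  have hI0 := hI.2 0 ⟨le_rfl, hM.le⟩
  rw [← integral_map_loss hX hI.1] at hm
  rw [← variance_map_loss hX hI.1] at hvar
  refine ⟨hI, by linarith, le_rfl, hM, h.isCoinsurance_of_deriv hX hI (by linarith) le_rfl hM
    (fun x hx => ?_) (fun x hx => ?_), ?_, hvar⟩
  · obtain rfl : x = 0 := le_antisymm hx.2 hx.1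
    exact le_antisymm hI0.2 hI0.1
  · obtain ⟨h1, h2⟩ := heq x hx
    refine ⟨h1, ?_⟩
    have e1 : w₀ - (1 + 0) * (∫ x, I x ∂(P.map X)) - x + I x = w₀ - x + I x - m := by
      rw [hm]; ring
    have e2 : w₀ - (1 + 0) * (∫ x, I x ∂(P.map X)) - 0 = w₀ - m := by rw [hm]; ring
    rw [e1, e2]
    linarith
  · have hc : (fun x => deriv U (clamp (minWealth P X w₀ 0) w₀
        (w₀ - (1 + 0) * (∫ y, I y ∂(P.map X)) - min x 0))) =ᵐ[P.map X] fun _ =>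
        deriv U (clamp (minWealth P X w₀ 0) w₀ (w₀ - (1 + 0) * (∫ y, I y ∂(P.map X)) - 0)) := by
      filter_upwards [IsInsuranceModel.ae_mem h] with x hx
      rw [min_eq_right hx.1]
    rw [IsInsuranceModel.IsBalanced, integral_congr_ae hc]
    simp

theorem solvesCoinsurance_of_isSolution (h : IsLossModel P X U w₀ 0) (hX : Measurable X)
    (hθ : 0 < θ) (hs : IsSolution P X U w₀ 0 ν θ 0 I)
    (hm : ∫ x, I x ∂(P.map X) ∈ Ioo (meanL P X U w₀ 0 ν) (meanU P X ν)) :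
    SolvesCoinsurance P X U w₀ ν (∫ x, I x ∂(P.map X)) (θ / 2) I := by
  refine ⟨hs.isContract, hm, by linarith, fun x hx => ?_,
    (integral_map_loss hX hs.isContract.1).symm, ?_⟩
  · have h1 := hs.isCoinsurance.2 x hx
    refine ⟨⟨h1.1.1, hs.lt_self hθ hx⟩, ?_⟩
    have h2 := h1.2
    simp only [h.clamp_sub_add hX hs.isContract ⟨hx.1.le, hx.2⟩,
      h.clamp_sub hX hs.isContract ⟨le_rfl, hs.deductible_lt.le⟩] at h2
    have e1 : w₀ - (1 + 0) * (∫ x, I x ∂(P.map X)) - x + I x =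
        w₀ - x + I x - ∫ x, I x ∂(P.map X) := by ring
    have e2 : w₀ - (1 + 0) * (∫ x, I x ∂(P.map X)) - 0 = w₀ - ∫ x, I x ∂(P.map X) := by ring
    rw [e1, e2] at h2
    linarith
  · rw [← variance_map_loss hX hs.isContract.1, hs.variance_eq]

theorem isSolution_of_solvesDeductibleCoinsurance (h : IsLossModel P X U w₀ ρ)
    (hX : Measurable X) (hρ : 0 < ρ) (hs : SolvesDeductibleCoinsurance P X U w₀ ρ ν m d I)
    (hic : IsIncentiveCompatible P X I) : ∃ θ, IsSolution P X U w₀ ρ ν θ d I := by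
  have : IsProbabilityMeasure (P.map X) := Measure.isProbabilityMeasure_map hX.aemeasurable
  obtain ⟨hI, hmm, hd, hzero, heq, hm, hvar⟩ := hs
  rw [← integral_map_loss hX hI.1] at hm
  rw [← variance_map_loss hX hI.1] at hvar
  have hd0 : 0 ≤ d := (valueAtRisk_nonneg ρ).trans hd.1.le
  have hm0 : 0 < m := lt_of_le_of_lt (integral_nonneg fun ω => le_max_right _ _) hmm.1
  have hdm : d ∈ Icc 0 (lossSup P X) := ⟨hd0, hd.2.le⟩
  have hMm : lossSup P X ∈ Icc 0 (lossSup P X) := ⟨(IsInsuranceModel.sup_pos h).le, le_rfl⟩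
  subst hm
  have hint := h.integral_deriv_min hX hI hdm
  set C := deriv U (w₀ - (1 + ρ) * (∫ x, I x ∂(P.map X)) - d) -
    (1 + ρ) * ∫ ω, deriv U (w₀ - (1 + ρ) * (∫ x, I x ∂(P.map X)) - min (X ω) d) ∂P with hC
  have hmρ : 0 < (∫ x, I x ∂(P.map X)) * ρ := mul_pos hm0 hρ
  -- incentive compatibility at the largest loss gives the sign of the multiplier
  have hC0 : 0 ≤ C := by
    obtain ⟨h1, h2⟩ := heq (lossSup P X) ⟨hd.2, le_rfl⟩
    have h3 := (hic.2 d hdm _ hMm hd.2.le).2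
    rw [hzero d ⟨hd0, le_rfl⟩] at h3
    have h4 := (IsInsuranceModel.strictAntiOn_sub h hI).antitoneOn
      (a := w₀ - (1 + ρ) * (∫ x, I x ∂(P.map X)) - lossSup P X + I (lossSup P X))
      (b := w₀ - (1 + ρ) * (∫ x, I x ∂(P.map X)) - d)
      ⟨by linarith [h1.1], by linarith [h1.2]⟩ ⟨by linarith [hd.2], by linarith⟩ (by linarith)
    simp only [h.clamp_sub_add hX hI hMm, h.clamp_sub hX hI hdm] at h4
    have h5 : 0 ≤ I (lossSup P X) / ((∫ x, I x ∂(P.map X)) * ρ) * C := by linarith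
    exact nonneg_of_mul_nonneg_right h5 (div_pos h1.1 hmρ)
  refine ⟨C / ((∫ x, I x ∂(P.map X)) * ρ), hI, div_nonneg hC0 hmρ.le, hd0, hd.2,
    h.isCoinsurance_of_deriv hX hI (div_nonneg hC0 hmρ.le) hd0 hd.2 hzero fun x hx => ?_, ?_, hvar⟩
  · obtain ⟨h1, h2⟩ := heq x hx
    refine ⟨h1, ?_⟩
    have e : C / ((∫ x, I x ∂(P.map X)) * ρ) * I x = I x / ((∫ x, I x ∂(P.map X)) * ρ) * C := by
      ring
    rw [e]
    linarith
  · rw [IsInsuranceModel.IsBalanced, hint, h.clamp_sub hX hI hdm, ← hC, mul_comm ρ]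
    exact div_mul_cancel₀ _ hmρ.ne'

theorem solvesDeductibleCoinsurance_of_isSolution (h : IsLossModel P X U w₀ ρ)
    (hX : Measurable X) (hρ : 0 < ρ) (hθ : 0 < θ) (hs : IsSolution P X U w₀ ρ ν θ d I)
    (hm : ∫ x, I x ∂(P.map X) ∈ Ioo (meanL P X U w₀ ρ ν) (meanU P X ν)) :
    SolvesDeductibleCoinsurance P X U w₀ ρ ν (∫ x, I x ∂(P.map X)) d I := by
  have hdm : d ∈ Icc 0 (lossSup P X) := ⟨hs.deductible_nonneg, hs.deductible_lt.le⟩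
  refine ⟨hs.isContract, hm, ⟨hs.valueAtRisk_lt h hX hθ hρ, hs.deductible_lt⟩,
    hs.isCoinsurance.1, fun x hx => ?_, (integral_map_loss hX hs.isContract.1).symm, ?_⟩
  · obtain ⟨h1, h2⟩ := hs.isCoinsurance.2 x hx
    have hx0 : 0 < x := hdm.1.trans_lt hx.1
    have hb := hs.isBalanced
    rw [IsInsuranceModel.IsBalanced, h.integral_deriv_min hX hs.isContract hdm,
      h.clamp_sub hX hs.isContract hdm] at hb
    simp only [h.clamp_sub_add hX hs.isContract ⟨hx0.le, hx.2⟩,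
      h.clamp_sub hX hs.isContract hdm] at h2
    refine ⟨⟨h1.1, hs.lt_self hθ ⟨hx0, hx.2⟩⟩, ?_⟩
    rw [← hb]
    have hmpos := hs.mean_pos h hX
    have e : I x / ((∫ x, I x ∂(P.map X)) * ρ) * (θ * (ρ * ∫ x, I x ∂(P.map X))) = θ * I x := by
      field_simp
    rw [e]
    linarith
  · rw [← variance_map_loss hX hs.isContract.1, hs.variance_eq]

end IsLossModel

end VarianceContract

theorem theorem3p1 {Ω : Type*} [MeasurableSpace Ω] (P : Measure Ω) [IsProbabilityMeasure P]
    (X : Ω → ℝ) (hX : Measurable X) (hX0 : ∀ᵐ ω ∂P, 0 ≤ X ω) (hXb : ∃ C : ℝ, ∀ᵐ ω ∂P, X ω ≤ C)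
    (hF : StrictMonoOn (VarianceContract.lossCdf P X) (Ioo 0 (VarianceContract.lossSup P X)))
    (w₀ ρ ν : ℝ) (hρ : 0 ≤ ρ) (hν : 0 < ν)
    (U : ℝ → ℝ) (S : Set ℝ) (hU : VarianceContract.IsUtilityOn U S)
    -- all wealth levels that indemnity functions can lead to lie in the domain of the utility
    (hS : Icc (w₀ - VarianceContract.lossSup P X - VarianceContract.premium P ρ X) w₀ ⊆ S)
    -- the variance bound is binding
    (hbind : ν < variance (fun ω => VarianceContract.stopLoss
      (VarianceContract.arrowDeductible P X U w₀ ρ) (X ω)) P) :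
    -- no safety loading
    (ρ = 0 → ∃ m β : ℝ, ∃ I : ℝ → ℝ,
      VarianceContract.SolvesCoinsurance P X U w₀ ν m β I ∧
      VarianceContract.IsIncentiveCompatible P X I ∧
      VarianceContract.IsOptimal P X U w₀ ρ ν I ∧
      (∀ J : ℝ → ℝ, VarianceContract.IsOptimal P X U w₀ ρ ν J → ∀ᵐ ω ∂P, J (X ω) = I (X ω)) ∧
      (∀ (m' β' : ℝ) (I' : ℝ → ℝ), VarianceContract.SolvesCoinsurance P X U w₀ ν m' β' I' →
        m' = m ∧ β' = β ∧ ∀ x ∈ Icc 0 (VarianceContract.lossSup P X), I' x = I x)) ∧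
    -- positive safety loading
    (0 < ρ → ∃ m d : ℝ, ∃ I : ℝ → ℝ,
      VarianceContract.SolvesDeductibleCoinsurance P X U w₀ ρ ν m d I ∧
      VarianceContract.IsIncentiveCompatible P X I ∧
      VarianceContract.IsOptimal P X U w₀ ρ ν I ∧
      (∀ J : ℝ → ℝ, VarianceContract.IsOptimal P X U w₀ ρ ν J → ∀ᵐ ω ∂P, J (X ω) = I (X ω)) ∧
      (∀ (m' d' : ℝ) (I' : ℝ → ℝ),
        VarianceContract.SolvesDeductibleCoinsurance P X U w₀ ρ ν m' d' I' →
        VarianceContract.IsIncentiveCompatible P X I' →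
        m' = m ∧ d' = d ∧ ∀ x ∈ Icc 0 (VarianceContract.lossSup P X), I' x = I x)) ∧
    -- an optimal indemnity has a positive deductible if and only if the loading is positive
    (∀ J : ℝ → ℝ, VarianceContract.IsOptimal P X U w₀ ρ ν J →
      ((∃ δ > 0, ∀ᵐ ω ∂P, X ω ≤ δ → J (X ω) = 0) ↔ 0 < ρ)) := by
  have hνX : 0 < variance (fun ω => VarianceContract.stopLoss
      (VarianceContract.arrowDeductible P X U w₀ ρ) (X ω)) P := hν.trans hbind
  have h : VarianceContract.IsLossModel P X U w₀ ρ :=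
    VarianceContract.isLossModel hX hX0 hXb hF (VarianceContract.lossSup_pos hX0 hXb hνX) hρ hU hS
  rw [← VarianceContract.variance_map_loss hX (VarianceContract.measurable_stopLoss _)] at hbind
  obtain ⟨θ, d, I, hθ, hs⟩ := h.exists_isSolution hX hν hbind
  have hm := hs.mean_mem h hX hθ hν hbind
  refine ⟨fun hρ0 => ?_, fun hρ0 => ?_, fun J hJ => hs.deductible_iff h hX hJ⟩
  · have hd := hs.deductible_eq_zero h hX hρ0
    subst hρ0 hd
    refine ⟨_, θ / 2, I, h.solvesCoinsurance_of_isSolution hX hθ hs hm,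
      hs.isIncentiveCompatible h hX, hs.isOptimal h hX, fun J hJ => hs.ae_eq h hX hJ,
      fun m' β' I' hs' => ?_⟩
    have hs2 := h.isSolution_of_solvesCoinsurance hX hs'
    obtain ⟨-, hβ, hI⟩ := hs.unique hs2 h hX
    refine ⟨?_, by linarith, hI⟩
    rw [← hs'.2.2.2.2.1, ← VarianceContract.integral_map_loss hX hs'.1.1]
    refine integral_congr_ae ?_
    filter_upwards [VarianceContract.IsInsuranceModel.ae_mem h] with x hx using hI x hx
  · refine ⟨_, d, I, h.solvesDeductibleCoinsurance_of_isSolution hX hρ0 hθ hs hm,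
      hs.isIncentiveCompatible h hX, hs.isOptimal h hX, fun J hJ => hs.ae_eq h hX hJ,
      fun m' d' I' hs' hic => ?_⟩
    obtain ⟨θ', hs2⟩ := h.isSolution_of_solvesDeductibleCoinsurance hX hρ0 hs' hic
    obtain ⟨hd, -, hI⟩ := hs.unique hs2 h hX
    refine ⟨?_, hd, hI⟩
    rw [← hs'.2.2.2.2.2.1, ← VarianceContract.integral_map_loss hX hs'.1.1]
    refine integral_congr_ae ?_
    filter_upwards [VarianceContract.IsInsuranceModel.ae_mem h] with x hx using hI x hx
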